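/- Let $(\Omega,\mathcal A,\mathbb P)$ be a probability space carrying independent random variables $w_1,u_1,w_2,u_2,\dots$, where each $w_i$ is exponential with mean $1$ and each $u_i$ is uniform on $[0,1]$, and let $t_i=w_1+\dots+w_i$. Let $q:\mathbb R_+\times\Omega\to\mathbb R_+$ be jointly measurable, put $r_i=\sup\{r:\int_0^r q_s\,ds<t_i\}$, $K=\{(r_i,u_i): i\ge 1,\ r_i<\infty\}$ and $K_t=K\cap([0,t]\times[0,1])$, let $\mathcal F=(\mathcal F_t)$ be the natural filtration of $(K_t)$, and let $\zeta=\lim_{n\to\infty}\inf\{t:q_t\ge n\}$. A real \emph{hybrid jump process} (hjp) on $[0,\zeta)$ with data $(q,D,\Delta)$ is a process of the form $$X_t=X_0+\int_0^t D_s\,ds+\sum_{(s,u)\in K_t}\Delta_s(u),\qquad t<\zeta,$$ with $X_0$ real and $\mathcal F_0$-measurable, where $D:[0,\zeta)\times\Omega\to\mathbb R$ and $\Delta:[0,\zeta)\times\Omega\to L^\infty([0,1])$ (with $[0,\zeta)\times\Omega$ denoting $\{(t,\omega):t<\zeta(\omega)\}$) are such that: (1) on $[0,\zeta)\times\Omega$,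 $q$, $D$ and $\Delta$ are jointly measurable and adapted to $\mathcal F$; (2) $t\mapsto\Delta_t$ is left-continuous in $L^\infty([0,1])$, and in the sum $\Delta$ is represented by a function of $(t,\omega,u)$ that is measurable for the product of the $\mathcal F$-predictable and the Borel $\sigma$-algebra; (3) $\zeta$ and the times $\zeta\wedge\inf\{t:\int_0^t|D_s|\,ds\ge n\}$, $n\ge 0$, are $\mathcal F$-stopping times, and the latter tend to $\zeta$ almost surely as $n\to\infty$; (4) $|\Delta_t(u,\omega)|$ is bounded by a constant for a.e. $(t,u,\omega)$ with $t<\zeta(\omega)$. For such $X$ define $$\mu_t(X)=D_t+q_t\int_0^1\Delta_t(u)\,du,\qquad M_t(X)=X_t-X_0-\int_0^t\mu_s(X)\,ds,\qquad \langle X\rangle_t=\int_0^t q_s\int_0^1\Delta_s(u)^2\,du\,ds .$$ \textbf{Theorem (General sample path estimate).} Let $X$ be a real hjp on $[0,\zeta)$ with jump size bounded by $c_\Delta>0$, that is, $|\Delta_t(u,\omega)|\le c_\Delta$ for a.e. $(t,u,\omega)$ with $t<\zeta(\omega)$. Then for all $\lambda,a>0$ and each sign $\bullet\in\{+,-\}$,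 $$\mathbb P\Big(\bullet M_t(X)\ge a+\tfrac{\lambda}{2}e^{\lambda c_\Delta}\langle X\rangle_t\ \text{ for some } t<\zeta\Big)\le e^{-\lambda a}.$$ -/

import Mathlib

open MeasureTheory ProbabilityTheory Filter Topology Set
open scoped NNReal ENNReal

/-- Measurability, with respect to the trace of the σ-algebra `m` on `s`, of a function that only
matters on the set `s`. -/
def TraceMeasurable {α β : Type*} [MeasurableSpace β] (m : MeasurableSpace α) (s : Set α)
    (f : α → β) : Prop :=
  Measurable[m.comap ((↑) : s → α)] (fun x : s => f x)

namespace HybridJump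

/-- Lebesgue measure on the time axis `[0,∞)`. -/
noncomputable def timeMeasure : Measure ℝ≥0 :=
  ((volume : Measure ℝ).restrict (Ici 0)).map Real.toNNReal

instance : SFinite timeMeasure := by
  unfold timeMeasure
  infer_instance

variable {Ω : Type*}

/-- The points `t_i = w_0 + ⋯ + w_i` of the driving point process with interarrival times `w`. -/
noncomputable def arrivalTime (w : ℕ → Ω → ℝ) (i : ℕ) (ω : Ω) : ℝ :=
  ∑ j ∈ Finset.range (i + 1), w j ω

/-- The cumulative transition rate `∫_0^r q_s ds`. -/
noncomputable def cumulativeRate (q : ℝ≥0 → Ω → ℝ≥0) (r : ℝ≥0) (ω : Ω) : ℝ≥0∞ :=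
  ∫⁻ s in Iic r, (q s ω : ℝ≥0∞) ∂timeMeasure

/-- The `i`-th jump time `r_i = sup {r : ∫_0^r q_s ds < t_i}`; the value `∞` means that this jump
never happens. -/
noncomputable def jumpTime (w : ℕ → Ω → ℝ) (q : ℝ≥0 → Ω → ℝ≥0) (i : ℕ) (ω : Ω) : ℝ≥0∞ :=
  ⨆ (r : ℝ≥0) (_ : cumulativeRate q r ω < ENNReal.ofReal (arrivalTime w i ω)), (r : ℝ≥0∞)

/-- The random set `K = {(r_i, u_i)}` of (finite) jump times with their sample values. -/
def jumpPoints (w : ℕ → Ω → ℝ) (u : ℕ → Ω → unitInterval) (q : ℝ≥0 → Ω → ℝ≥0) (ω : Ω) :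
    Set (ℝ≥0 × unitInterval) :=
  {p | ∃ i, jumpTime w q i ω = (p.1 : ℝ≥0∞) ∧ u i ω = p.2}

/-- `lim_{n → ∞} inf {t : q_t ≥ n}`. The infima increase with `n`, so the limit is a supremum. -/
noncomputable def explosionTime (q : ℝ≥0 → Ω → ℝ≥0) (ω : Ω) : ℝ≥0∞ :=
  ⨆ n : ℕ, ⨅ (t : ℝ≥0) (_ : (n : ℝ≥0) ≤ q t ω), (t : ℝ≥0∞)

theorem cumulativeRate_mono (q : ℝ≥0 → Ω → ℝ≥0) (ω : Ω) :
    Monotone fun r => cumulativeRate q r ω :=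
  fun _ _ h => lintegral_mono_set (Iic_subset_Iic.2 h)

variable [mΩ : MeasurableSpace Ω]

theorem measurable_jumpTime {w : ℕ → Ω → ℝ} {q : ℝ≥0 → Ω → ℝ≥0}
    (hw : ∀ i, Measurable (w i)) (hq : Measurable (Function.uncurry q)) (i : ℕ) :
    Measurable (jumpTime w q i) := by
  have hA : Measurable (arrivalTime w i) := Finset.measurable_sum _ fun j _ => hw j
  have hC : ∀ r, Measurable (cumulativeRate q r) := fun r => by
    have h : Measurable (Function.uncurry fun (ω : Ω) (s : ℝ≥0) => (q s ω : ℝ≥0∞)) :=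
      (hq.comp measurable_swap).coe_nnreal_ennreal
    exact h.lintegral_prod_right'
  refine measurable_of_Ioi fun x => ?_
  have hset : jumpTime w q i ⁻¹' Ioi x = ⋃ p : ℚ, {ω | x < ((Real.toNNReal p : ℝ≥0) : ℝ≥0∞) ∧
      cumulativeRate q (Real.toNNReal p) ω < ENNReal.ofReal (arrivalTime w i ω)} := by
    ext ω
    simp only [jumpTime, mem_preimage, mem_Ioi, lt_iSup_iff, mem_iUnion, mem_ofPred_eq]
    constructor
    · rintro ⟨r, hr, hx⟩
      obtain ⟨p, -, hp1, hp2⟩ := ENNReal.lt_iff_exists_rat_btwn.1 hx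
      exact ⟨p, hp1, (cumulativeRate_mono q ω (ENNReal.coe_lt_coe.1 hp2).le).trans_lt hr⟩
    · rintro ⟨p, hx, hp⟩
      exact ⟨Real.toNNReal p, hp, hx⟩
  rw [hset]
  exact MeasurableSet.iUnion fun p =>
    (MeasurableSet.const _).inter (measurableSet_lt (hC _) hA.ennreal_ofReal)

/-- The natural filtration of `(K_t)`, where `K_t = K ∩ ([0,t] × [0,1])`: the σ-algebra at time `t`
is generated by the events that `K_t` hits a Borel set `B`, i.e. that `K` hits a Borel subset `B`
of `[0,t] × [0,1]`. (The numbers of points of `K_t` in Borel sets generate the same σ-algebra.) -/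
def naturalFiltration (w : ℕ → Ω → ℝ) (u : ℕ → Ω → unitInterval) (q : ℝ≥0 → Ω → ℝ≥0)
    (hw : ∀ i, Measurable (w i)) (hu : ∀ i, Measurable (u i))
    (hq : Measurable (Function.uncurry q)) : Filtration ℝ≥0 mΩ where
  seq t := MeasurableSpace.generateFrom
    {E | ∃ B : Set (ℝ≥0 × unitInterval), MeasurableSet B ∧ B ⊆ Iic t ×ˢ univ ∧
      E = {ω | (jumpPoints w u q ω ∩ B).Nonempty}}
  mono' s t hst := MeasurableSpace.generateFrom_mono fun E hE => by
    obtain ⟨B, hB, hBs, rfl⟩ := hE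
    exact ⟨B, hB, hBs.trans (prod_mono (Iic_subset_Iic.2 hst) subset_rfl), rfl⟩
  le' t := MeasurableSpace.generateFrom_le fun E hE => by
    obtain ⟨B, hB, -, rfl⟩ := hE
    have hset : {ω | (jumpPoints w u q ω ∩ B).Nonempty} = ⋃ i : ℕ,
        (fun ω => (jumpTime w q i ω, u i ω)) ⁻¹'
          ((fun p : ℝ≥0 × unitInterval => ((p.1 : ℝ≥0∞), p.2)) '' B) := by
      ext ω
      simp only [jumpPoints, mem_ofPred_eq, mem_iUnion, mem_preimage, mem_image, Prod.mk.injEq]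
      constructor
      · rintro ⟨p, ⟨i, h1, h2⟩, hp⟩
        exact ⟨i, p, hp, h1.symm, h2.symm⟩
      · rintro ⟨i, p, hp, h1, h2⟩
        exact ⟨p, ⟨i, h1.symm, h2.symm⟩, hp⟩
    rw [hset]
    refine MeasurableSet.iUnion fun i =>
      ((measurable_jumpTime hw hq i).prodMk (hu i)) ?_
    have he : MeasurableEmbedding (fun p : ℝ≥0 × unitInterval => ((p.1 : ℝ≥0∞), p.2)) :=
      (ENNReal.isOpenEmbedding_coe.measurableEmbedding).prodMap MeasurableEmbedding.id
    exact he.measurableSet_image' hB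

/-- `τ` is a localizing sequence for `ζ`: an increasing sequence of stopping times with limit
the stopping time `ζ`. -/
structure IsLocalizingSequenceFor (𝓕 : Filtration ℝ≥0 mΩ) (P : Measure Ω)
    (τ : ℕ → Ω → ℝ≥0∞) (ζ : Ω → ℝ≥0∞) : Prop where
  isStoppingTime_limit : IsStoppingTime 𝓕 ζ
  isStoppingTime : ∀ n, IsStoppingTime 𝓕 (τ n)
  mono : ∀ᵐ ω ∂P, Monotone fun n => τ n ω
  tendsto : ∀ᵐ ω ∂P, Tendsto (fun n => τ n ω) atTop (𝓝 (ζ ω))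

end HybridJump

open HybridJump

/-- A real-valued hybrid jump process on the probability space `(Ω, P)`, given by the driving
variables `w`, `u`, the initial value, and the data `(q, D, Δ)`: transition rate `rate`,
derivative `deriv` and jump function `jump`. Only the restriction of the data to
`[0,ζ) × Ω = {(t, ω) : t < ζ ω}` is subject to the adaptedness and regularity assumptions. -/
structure HybridJumpProcess {Ω : Type*} [mΩ : MeasurableSpace Ω] (P : Measure Ω) where
  /-- the interarrival times `w_i` -/
  w : ℕ → Ω → ℝ
  /-- the sample values `u_i` -/
  u : ℕ → Ω → unitInterval
  measurable_w : ∀ i, Measurable (w i)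
  measurable_u : ∀ i, Measurable (u i)
  /-- the `w_i` are exponential with mean one -/
  law_w : ∀ i, HasLaw (w i) (expMeasure 1) P
  /-- the `u_i` are uniform on `[0,1]` -/
  law_u : ∀ i, HasLaw (u i) (volume : Measure unitInterval) P
  indep_w_u : ∀ i, IndepFun (w i) (u i) P
  indep : iIndepFun (fun i ω => (w i ω, u i ω)) P
  /-- the transition rate `q` -/
  rate : ℝ≥0 → Ω → ℝ≥0
  measurable_rate : Measurable (Function.uncurry rate)
  /-- `q` is adapted to the filtration that it induces -/
  adapted_rate : ∀ t : ℝ≥0, TraceMeasurable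
    (naturalFiltration w u rate measurable_w measurable_u measurable_rate t)
    {ω | (t : ℝ≥0∞) < explosionTime rate ω} (rate t)
  /-- the initial value `X_0` -/
  init : Ω → ℝ
  measurable_init :
    Measurable[naturalFiltration w u rate measurable_w measurable_u measurable_rate 0] init
  /-- the derivative `D` -/
  deriv : ℝ≥0 → Ω → ℝ
  measurable_deriv : TraceMeasurable inferInstance
    {p : ℝ≥0 × Ω | (p.1 : ℝ≥0∞) < explosionTime rate p.2} (Function.uncurry deriv)
  adapted_deriv : ∀ t : ℝ≥0, TraceMeasurable
    (naturalFiltration w u rate measurable_w measurable_u measurable_rate t)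
    {ω | (t : ℝ≥0∞) < explosionTime rate ω} (deriv t)
  /-- `∫_0^t |D_s| ds` is locally finite on `[0,ζ)` -/
  locallyFinite_deriv : IsLocalizingSequenceFor
    (naturalFiltration w u rate measurable_w measurable_u measurable_rate) P
    (fun n ω => explosionTime rate ω ⊓
      ⨅ (t : ℝ≥0) (_ : (n : ℝ≥0∞) ≤ ∫⁻ s in Iic t, ‖deriv s ω‖ₑ ∂timeMeasure), (t : ℝ≥0∞))
    (explosionTime rate)
  /-- the jump function `Δ`, written `jump t ω u = Δ_t(ω)(u)` -/
  jump : ℝ≥0 → Ω → unitInterval → ℝ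
  /-- `Δ_t` takes values in `L^∞([0,1])` -/
  memLp_jump : ∀ (t : ℝ≥0) (ω : Ω), (t : ℝ≥0∞) < explosionTime rate ω → MemLp (jump t ω) ∞ volume
  /-- `Δ` is (jointly) measurable and adapted. An adapted left-continuous `L^∞`-valued process has a
  representative that is measurable for the product of the predictable and the Borel σ-algebra, and
  it is such a representative, unique up to `dt ⊗ du ⊗ P`-null sets, whose values at the points of
  `K` are the jumps of the process. (The values at the random points of `K` would be meaningless
  for a general representative of the `L^∞`-classes.) -/
  predictable_jump : TraceMeasurable
    (MeasurableSpace.prod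
      (naturalFiltration w u rate measurable_w measurable_u measurable_rate).predictable
      inferInstance)
    {p : (ℝ≥0 × Ω) × unitInterval | (p.1.1 : ℝ≥0∞) < explosionTime rate p.1.2}
    (fun p => jump p.1.1 p.1.2 p.2)
  /-- `t ↦ Δ_t` is left-continuous in `L^∞([0,1])` -/
  leftContinuous_jump : ∀ (t : ℝ≥0) (ω : Ω), (t : ℝ≥0∞) < explosionTime rate ω →
    Tendsto (fun s => eLpNorm (fun v => jump s ω v - jump t ω v) ∞ volume) (𝓝[<] t) (𝓝 0)
  /-- the jump function is bounded by some constant -/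
  bounded_jump : ∃ c : ℝ, ∀ᵐ p ∂(timeMeasure.prod
      ((volume : Measure unitInterval).prod P)),
    (p.1 : ℝ≥0∞) < explosionTime rate p.2.2 → |jump p.1 p.2.2 p.2.1| ≤ c

namespace HybridJumpProcess

variable {Ω : Type*} [mΩ : MeasurableSpace Ω] {P : Measure Ω} (X : HybridJumpProcess P)

/-- The terminal time `ζ`. -/
noncomputable def lifetime (ω : Ω) : ℝ≥0∞ := explosionTime X.rate ω

/-- The jump size of `X` is bounded by `c`: for a.e. `(t, u, ω)` with `t < ζ ω`, one has
`|Δ_t(u, ω)| ≤ c`. -/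
def JumpBoundedBy (c : ℝ) : Prop :=
  ∀ᵐ p ∂(timeMeasure.prod ((volume : Measure unitInterval).prod P)),
    (p.1 : ℝ≥0∞) < X.lifetime p.2.2 → |X.jump p.1 p.2.2 p.2.1| ≤ c

/-- `K_t`, the jump times up to time `t` with their sample values. -/
def jumpPointsUpTo (t : ℝ≥0) (ω : Ω) : Set (ℝ≥0 × unitInterval) :=
  {p ∈ jumpPoints X.w X.u X.rate ω | p.1 ≤ t}

/-- The process `X_t = X_0 + ∫_0^t D_s ds + ∑_{(s,u) ∈ K_t} Δ_s(u)`, for `t < ζ`. -/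
noncomputable def process (t : ℝ≥0) (ω : Ω) : ℝ :=
  X.init ω + (∫ s in Iic t, X.deriv s ω ∂timeMeasure) + ∑ᶠ p ∈ X.jumpPointsUpTo t ω, X.jump p.1 ω p.2

/-- The drift `μ_t(X) = D_t + q_t ∫_0^1 Δ_t(u) du`. -/
noncomputable def drift (t : ℝ≥0) (ω : Ω) : ℝ :=
  X.deriv t ω + X.rate t ω * ∫ v, X.jump t ω v

/-- The compensator `X_0 + ∫_0^t μ_s(X) ds`. -/
noncomputable def compensator (t : ℝ≥0) (ω : Ω) : ℝ :=
  X.init ω + ∫ s in Iic t, X.drift s ω ∂timeMeasure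

/-- The compensated process `M_t(X)`: the process minus its compensator. -/
noncomputable def compensated (t : ℝ≥0) (ω : Ω) : ℝ :=
  X.process t ω - X.compensator t ω

/-- The diffusivity `σ_t²(X) = q_t ∫_0^1 Δ_t(u)² du`. -/
noncomputable def diffusivity (t : ℝ≥0) (ω : Ω) : ℝ :=
  X.rate t ω * ∫ v, X.jump t ω v ^ 2

/-- The predictable quadratic variation `⟨X⟩_t = ∫_0^t σ_s²(X) ds`. -/
noncomputable def quadraticVariation (t : ℝ≥0) (ω : Ω) : ℝ :=
  ∫ s in Iic t, X.diffusivity s ω ∂timeMeasure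

end HybridJumpProcess

/-!
For a sign `ε = ±1` put `θ = ε l`, and let `q`, `Δ` be the rate and the jump function of `X`. The
exponential process
`Z_t = exp (θ ∑_{(s,v) ∈ K_t} Δ_s(v) - ∫_0^t q_s (∫ e^{θ Δ_s(v)} dv - 1) ds)`
agrees before `ζ` with a nonnegative supermartingale that starts at `1`, so that it reaches
`e^{l a}` with probability at most `e^{-l a}`. Since `e^x ≤ 1 + x + x²/2 e^{|x|}` and `|Δ| ≤ c`, the exponent is at least
`ε l M_t - l²/2 e^{l c} ⟨X⟩_t`; hence `Z_t ≥ e^{l a}` whenever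
`ε M_t ≥ a + l/2 e^{l c} ⟨X⟩_t` (`IsRegular.le_multiplicativeChain`).

The supermartingale property is proved in the time scale of the driving process, in which the points
`w_0 + ⋯ + w_i` form a Poisson process with unit rate. Between two of its points `Z` is a function
of the past points, and at the next point it is multiplied by a factor whose mean is known given the
past and the time of this point. Stopping at the level `b` therefore reduces to a statement about
one exponential variable, `lintegral_step_le`, which holds for arbitrary measurable factors with
values in `[0,∞]`. Induction over the points gives the maximal inequality `measure_reaches_le`.

It remains to see that the rate and the jump function, read in this time scale, depend on the past
points only, up to and including the next point.
* Before the next jump, an event of the natural filtration is determined by the past points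
  (`exists_past_event`).
* The cumulative rate is adapted only up to null sets, because the rate is jointly measurable and
  adapted, but need not be progressively measurable (`exists_measurable_integral_ae_eq`).
* Thus the inverse of the cumulative rate, and by induction each jump time, is a function of the past
  points (`exists_past_inverseRate`, `jumpTimeFromPast`). By predictability the same is true of the
  jump function, even at the time of the next jump (`exists_past_jump`).

The lifetime `ζ` is not determined by the past points: the rate may explode at a time that depends
on the future points, which then become jumps at this time. So only functions of the past are
constructed that agree with the data of `X` before `ζ`; they have unspecified values afterwards. This
suffices, because the event in question concerns only times before `ζ`, and it is the reason for
admitting arbitrary factors in the maximal inequality.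
-/

/-! ### Stopping at one exponential time -/

/-- The function `x ↦ e^{-x}` on `[0,∞]`, with value `0` at `∞`. -/
noncomputable def expNeg (x : ℝ≥0∞) : ℝ≥0∞ := EReal.exp (-(x : EReal))

theorem expNeg_antitone : Antitone expNeg := fun x y h => by
  unfold expNeg
  rw [EReal.exp_le_exp_iff, EReal.neg_le_neg_iff]
  exact_mod_cast h

@[fun_prop]
theorem measurable_expNeg : Measurable expNeg := expNeg_antitone.measurable

theorem expNeg_ofReal {x : ℝ} (hx : 0 ≤ x) :
    expNeg (ENNReal.ofReal x) = ENNReal.ofReal (Real.exp (-x)) := by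
  unfold expNeg
  rw [EReal.coe_ennreal_ofReal, max_eq_left hx, ← EReal.coe_neg, EReal.exp_coe]

@[simp] theorem expNeg_top : expNeg ∞ = 0 := by simp [expNeg]

theorem lintegral_exp_neg_Ioi (x : ℝ) :
    ∫⁻ v in Ioi x, ENNReal.ofReal (Real.exp (-v)) = ENNReal.ofReal (Real.exp (-x)) := by
  rw [← ofReal_integral_eq_lintegral_ofReal, integral_exp_neg_Ioi]
  · exact integrableOn_exp_neg_Ioi x
  · exact Eventually.of_forall fun _ => (Real.exp_pos _).le

theorem expNeg_eq_lintegral (x : ℝ≥0∞) :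
    expNeg x = ∫⁻ v in Ioi (0 : ℝ), {v | x ≤ ENNReal.ofReal v}.indicator
      (fun v => ENNReal.ofReal (Real.exp (-v))) v := by
  rcases eq_or_ne x ∞ with rfl | hx
  · simp
  lift x to ℝ≥0 using hx
  have h1 : expNeg (x : ℝ≥0∞) = ENNReal.ofReal (Real.exp (-x)) := by
    rw [← expNeg_ofReal x.coe_nonneg, ENNReal.ofReal_coe_nnreal]
  have h2 : Ici (x : ℝ) ⊆ {v | (x : ℝ≥0∞) ≤ ENNReal.ofReal v} := fun v hv => by
    rw [mem_ofPred_eq, ← ENNReal.ofReal_coe_nnreal]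
    exact ENNReal.ofReal_le_ofReal hv
  have hm : MeasurableSet {v | (x : ℝ≥0∞) ≤ ENNReal.ofReal v} :=
    measurableSet_le measurable_const ENNReal.measurable_ofReal
  rw [h1, ← lintegral_exp_neg_Ioi, lintegral_indicator hm, Measure.restrict_restrict hm]
  refine setLIntegral_congr ?_
  refine (ae_eq_set.2 ⟨?_, ?_⟩)
  · refine measure_mono_null (t := ∅) ?_ measure_empty
    rintro v ⟨hv, hv'⟩
    exact hv' ⟨h2 (mem_Ici.2 (le_of_lt hv)), lt_of_le_of_lt x.coe_nonneg hv⟩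
  · refine measure_mono_null (t := {(x : ℝ)}) ?_ (measure_singleton _)
    rintro v ⟨⟨hv, hv0⟩, hv'⟩
    have : (x : ℝ) ≤ v := by
      have := ENNReal.toReal_mono ENNReal.ofReal_ne_top hv
      rwa [ENNReal.toReal_ofReal (le_of_lt hv0)] at this
    exact le_antisymm (not_lt.1 hv') this

/-- On an initial segment of `(0,∞)`, the integral of `G` is bounded by any bound for the integrals
over the intervals `(0,w]` that it contains. -/
theorem setLIntegral_le_of_initial {G : ℝ → ℝ≥0∞} {A : Set ℝ} (hA0 : A ⊆ Ioi 0)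
    (hA : ∀ w ∈ A, ∀ w', 0 < w' → w' < w → w' ∈ A) {v : ℝ≥0∞}
    (hv : ∀ w ∈ A, ∫⁻ x in Ioc 0 w, G x ≤ v) : ∫⁻ x in A, G x ≤ v := by
  have hsub : A ⊆ {w | IsGreatest A w} ∪ ⋃ r : {r : ℚ // (r : ℝ) ∈ A}, Ioc (0 : ℝ) (r : ℚ) := by
    intro w hw
    by_cases h : ∃ w' ∈ A, w < w'
    · obtain ⟨w', hw', hlt⟩ := h
      obtain ⟨r, hr1, hr2⟩ := exists_rat_btwn hlt
      refine Or.inr (mem_iUnion.2 ⟨⟨r, hA w' hw' r ((hA0 hw).trans hr1) hr2⟩, hA0 hw, hr1.le⟩)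
    · push Not at h
      exact Or.inl ⟨hw, fun w' hw' => h w' hw'⟩
  have hnull : volume {w | IsGreatest A w} = 0 :=
    Set.Subsingleton.measure_zero (fun a ha b hb => ha.unique hb) _
  calc ∫⁻ x in A, G x
      ≤ ∫⁻ x in {w | IsGreatest A w} ∪ ⋃ r : {r : ℚ // (r : ℝ) ∈ A}, Ioc (0 : ℝ) (r : ℚ), G x :=
        lintegral_mono_set hsub
    _ ≤ (∫⁻ x in {w | IsGreatest A w}, G x) +
          ∫⁻ x in ⋃ r : {r : ℚ // (r : ℝ) ∈ A}, Ioc (0 : ℝ) (r : ℚ), G x :=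
        lintegral_union_le _ _ _
    _ = ∫⁻ x in ⋃ r : {r : ℚ // (r : ℝ) ∈ A}, Ioc (0 : ℝ) (r : ℚ), G x := by
        rw [setLIntegral_measure_zero _ _ hnull, zero_add]
    _ = ⨆ r : {r : ℚ // (r : ℝ) ∈ A}, ∫⁻ x in Ioc (0 : ℝ) (r : ℚ), G x := by
        refine setLIntegral_iUnion_of_directed _ ?_
        refine Monotone.directed_le (f := fun r : {r : ℚ // (r : ℝ) ∈ A} => Ioc (0 : ℝ) (r : ℚ)) ?_
        exact fun r s h => Ioc_subset_Ioc_right (by exact_mod_cast h)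
    _ ≤ v := iSup_le fun r => hv _ r.2

theorem measurableSet_of_initial {A : Set ℝ} (hA0 : A ⊆ Ioi 0)
    (hA : ∀ w ∈ A, ∀ w', 0 < w' → w' < w → w' ∈ A) : MeasurableSet A := by
  refine Set.OrdConnected.measurableSet ⟨fun x hx y hy z hz => ?_⟩
  rcases hz.2.eq_or_lt with rfl | h
  · exact hy
  · exact hA y hy z ((hA0 hx).trans_le hz.1) h

/-- The density of the first point of a point process with intensity `G`, integrated over an initial
segment `A`, and the probability that there is no point in `A` add up to at most one. -/
theorem lintegral_expNeg_mul_add_le {G : ℝ → ℝ≥0∞} (hG : Measurable G) {A : Set ℝ}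
    (hA0 : A ⊆ Ioi 0) (hA : ∀ w ∈ A, ∀ w', 0 < w' → w' < w → w' ∈ A) :
    (∫⁻ w in A, expNeg (∫⁻ x in Ioc 0 w, G x) * G w) + expNeg (∫⁻ x in A, G x) ≤ 1 := by
  classical
  set I : ℝ → ℝ≥0∞ := fun w => ∫⁻ x in Ioc 0 w, G x with hI
  have hImono : Monotone I := fun w w' h => lintegral_mono_set (Ioc_subset_Ioc_right h)
  have hIm : Measurable I := hImono.measurable
  have hAm := measurableSet_of_initial hA0 hA
  set e : ℝ → ℝ≥0∞ := fun v => ENNReal.ofReal (Real.exp (-v)) with he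
  have hem : Measurable e := by fun_prop
  set m : ℝ≥0∞ := ∫⁻ x in A, G x with hm
  have key : ∀ v : ℝ, 0 < v → ∫⁻ w in A ∩ {w | I w ≤ ENNReal.ofReal v}, G w ≤
      volume ({x : ℝ | ENNReal.ofReal x < m} ∩ Ioc 0 v) := by
    intro v hv
    have h1 : ∫⁻ w in A ∩ {w | I w ≤ ENNReal.ofReal v}, G w ≤ ENNReal.ofReal v := by
      refine setLIntegral_le_of_initial (inter_subset_left.trans hA0) ?_ (fun w hw => hw.2)
      rintro w ⟨hw, hwv⟩ w' hw' hlt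
      exact ⟨hA w hw w' hw' hlt, (hImono hlt.le).trans hwv⟩
    have h2 : ∫⁻ w in A ∩ {w | I w ≤ ENNReal.ofReal v}, G w ≤ m :=
      lintegral_mono_set inter_subset_left
    rcases lt_or_ge (ENNReal.ofReal v) m with h | h
    · have : {x : ℝ | ENNReal.ofReal x < m} ∩ Ioc 0 v = Ioc 0 v :=
        inter_eq_right.2 fun x hx => (ENNReal.ofReal_le_ofReal hx.2).trans_lt h
      rw [this, Real.volume_Ioc, sub_zero]
      exact h1
    · have hmt : m ≠ ∞ := (h.trans_lt ENNReal.ofReal_lt_top).ne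
      have : Ioo 0 m.toReal ⊆ {x : ℝ | ENNReal.ofReal x < m} ∩ Ioc 0 v := by
        intro x hx
        refine ⟨(ENNReal.ofReal_lt_iff_lt_toReal hx.1.le hmt).2 hx.2, hx.1, hx.2.le.trans ?_⟩
        exact ENNReal.toReal_le_of_le_ofReal hv.le h
      refine h2.trans ((le_of_eq ?_).trans (measure_mono this))
      rw [Real.volume_Ioo, sub_zero, ENNReal.ofReal_toReal hmt]
  have hset : MeasurableSet {p : ℝ × ℝ | I p.1 ≤ ENNReal.ofReal p.2} :=
    measurableSet_le (hIm.comp measurable_fst) (ENNReal.measurable_ofReal.comp measurable_snd)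
  have hml : MeasurableSet {x : ℝ | ENNReal.ofReal x < m} :=
    measurableSet_lt ENNReal.measurable_ofReal measurable_const
  have hA' : ∫⁻ w in A, expNeg (I w) * G w ≤
      ∫⁻ x in Ioi 0, {x : ℝ | ENNReal.ofReal x < m}.indicator e x := by
    calc ∫⁻ w in A, expNeg (I w) * G w
        = ∫⁻ w in A, ∫⁻ v in Ioi (0 : ℝ),
            {p : ℝ × ℝ | I p.1 ≤ ENNReal.ofReal p.2}.indicator (fun p => e p.2 * G p.1) (w, v) := by
          refine lintegral_congr fun w => ?_
          rw [expNeg_eq_lintegral, ← lintegral_mul_const]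
          · refine lintegral_congr fun v => ?_
            simp only [indicator_apply, mem_ofPred_eq]
            split_ifs <;> simp [he]
          · exact hem.indicator (measurableSet_le measurable_const ENNReal.measurable_ofReal)
      _ = ∫⁻ v in Ioi (0 : ℝ), ∫⁻ w in A,
            {p : ℝ × ℝ | I p.1 ≤ ENNReal.ofReal p.2}.indicator (fun p => e p.2 * G p.1) (w, v) := by
          refine lintegral_lintegral_swap (Measurable.aemeasurable ?_)
          exact ((hem.comp measurable_snd).mul (hG.comp measurable_fst)).indicator hset
      _ = ∫⁻ v in Ioi (0 : ℝ), e v * ∫⁻ w in A ∩ {w | I w ≤ ENNReal.ofReal v}, G w := by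
          refine lintegral_congr fun v => ?_
          have hs : MeasurableSet {w | I w ≤ ENNReal.ofReal v} :=
            measurableSet_le hIm measurable_const
          rw [inter_comm, ← Measure.restrict_restrict hs, ← lintegral_indicator hs,
            ← lintegral_const_mul _ (hG.indicator hs)]
          refine lintegral_congr fun w => ?_
          simp only [indicator_apply, mem_ofPred_eq]
          split_ifs <;> simp
      _ ≤ ∫⁻ v in Ioi (0 : ℝ), e v * volume ({x : ℝ | ENNReal.ofReal x < m} ∩ Ioc 0 v) :=
          setLIntegral_mono' measurableSet_Ioi fun v hv => by gcongr; exact key v hv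
      _ = ∫⁻ v in Ioi (0 : ℝ), ∫⁻ x in Ioi (0 : ℝ),
            {p : ℝ × ℝ | ENNReal.ofReal p.2 < m ∧ p.2 ≤ p.1}.indicator (fun p => e p.1) (v, x) := by
          refine lintegral_congr fun v => ?_
          have hs : MeasurableSet ({x : ℝ | ENNReal.ofReal x < m} ∩ Ioc 0 v) :=
            hml.inter measurableSet_Ioc
          rw [← lintegral_indicator measurableSet_Ioi, ← setLIntegral_const,
            ← lintegral_indicator hs]
          refine lintegral_congr fun x => ?_
          simp only [indicator_apply, mem_ofPred_eq, mem_inter_iff, mem_Ioc, mem_Ioi]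
          split_ifs <;> first | rfl | tauto
      _ = ∫⁻ x in Ioi (0 : ℝ), ∫⁻ v in Ioi (0 : ℝ),
            {p : ℝ × ℝ | ENNReal.ofReal p.2 < m ∧ p.2 ≤ p.1}.indicator (fun p => e p.1) (v, x) := by
          refine lintegral_lintegral_swap (Measurable.aemeasurable ?_)
          refine (hem.comp measurable_fst).indicator ?_
          exact (hml.preimage measurable_snd).inter (measurableSet_le measurable_snd measurable_fst)
      _ = ∫⁻ x in Ioi (0 : ℝ), {x : ℝ | ENNReal.ofReal x < m}.indicator e x := by
          refine setLIntegral_congr_fun measurableSet_Ioi fun x hx => ?_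
          by_cases h : ENNReal.ofReal x < m
          · rw [indicator_of_mem (by exact h), show e x = _ from (lintegral_exp_neg_Ioi x).symm,
              setLIntegral_congr (Ioi_ae_eq_Ici (a := x)),
              ← lintegral_indicator measurableSet_Ioi, ← lintegral_indicator measurableSet_Ici]
            refine lintegral_congr fun v => ?_
            simp only [indicator_apply, mem_ofPred_eq, mem_Ioi, mem_Ici, h, true_and]
            have : x ≤ v → 0 < v := fun h => lt_of_lt_of_le hx h
            split_ifs <;> first | rfl | tauto
          · rw [indicator_of_notMem (by exact h)]
            simp [h]
  calc _ ≤ (∫⁻ x in Ioi 0, {x : ℝ | ENNReal.ofReal x < m}.indicator e x) +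
        ∫⁻ x in Ioi 0, {x : ℝ | m ≤ ENNReal.ofReal x}.indicator e x := by
        refine add_le_add hA' (le_of_eq ?_)
        exact expNeg_eq_lintegral m
    _ = ∫⁻ x in Ioi 0, e x := by
        rw [← lintegral_add_left (hem.indicator hml)]
        refine lintegral_congr fun x => ?_
        simp only [indicator_apply, mem_ofPred_eq]
        rcases lt_or_ge (ENNReal.ofReal x) m with h | h
        · simp [h, not_le.2 h]
        · simp [h, not_lt.2 h]
    _ = 1 := by simp [he, lintegral_exp_neg_Ioi]
    _ ≤ 1 := le_rfl

/-- One step of the maximal inequality. The process starts at `z`, evolves as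
`z e^y e^{-∫_0^y G}` until an exponential time `w`, and is multiplied by a factor of mean `G w` at
the time `w`. If it is stopped at the level `b`, its mean does not increase. -/
theorem lintegral_step_le {G : ℝ → ℝ≥0∞} (hG : Measurable G) (z b : ℝ≥0∞)
    {E : ℝ → ℝ≥0∞}
    (hE : E = fun y => ENNReal.ofReal (Real.exp y) * expNeg (∫⁻ x in Ioc 0 y, G x)) {hit : Set ℝ}
    (hhit : hit = {w | ∃ y : ℚ, 0 ≤ y ∧ (y : ℝ) < w ∧ b ≤ z * E y}) :
    ∫⁻ w in Ioi (0 : ℝ), ENNReal.ofReal (Real.exp (-w)) *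
      (hit.indicator (fun _ => b) w + hitᶜ.indicator (fun w => z * (E w * G w)) w) ≤ z := by
  classical
  set e : ℝ → ℝ≥0∞ := fun v => ENNReal.ofReal (Real.exp (-v)) with he
  have hem : Measurable e := by fun_prop
  have hhit' : hit = ⋃ y : {y : ℚ // 0 ≤ y ∧ b ≤ z * E y}, Ioi (y.1 : ℝ) := by
    ext w
    simp only [hhit, mem_ofPred_eq, mem_iUnion, mem_Ioi, Subtype.exists]
    constructor
    · rintro ⟨y, h1, h2, h3⟩
      exact ⟨y, ⟨h1, h3⟩, h2⟩
    · rintro ⟨y, ⟨h1, h3⟩, h2⟩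
      exact ⟨y, h1, h2, h3⟩
  have hhm : MeasurableSet hit := by
    rw [hhit']
    exact MeasurableSet.iUnion fun _ => measurableSet_Ioi
  set A : Set ℝ := hitᶜ ∩ Ioi 0 with hAdef
  have hA0 : A ⊆ Ioi 0 := inter_subset_right
  have hA : ∀ w ∈ A, ∀ w', 0 < w' → w' < w → w' ∈ A := by
    rintro w ⟨hw, -⟩ w' h0 hlt
    refine ⟨fun h => hw ?_, h0⟩
    rw [hhit] at h ⊢
    obtain ⟨y, h1, h2, h3⟩ := h
    exact ⟨y, h1, h2.trans hlt, h3⟩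
  have hkey := lintegral_expNeg_mul_add_le hG hA0 hA
  have hee : ∀ w, e w * ENNReal.ofReal (Real.exp w) = 1 := fun w => by
    rw [he, ← ENNReal.ofReal_mul (Real.exp_pos _).le, ← Real.exp_add]
    simp
  have h1 : ∫⁻ w in Ioi (0 : ℝ), e w * hitᶜ.indicator (fun w => z * (E w * G w)) w =
      z * ∫⁻ w in A, expNeg (∫⁻ x in Ioc 0 w, G x) * G w := by
    have hmeas : Measurable fun w => expNeg (∫⁻ x in Ioc 0 w, G x) * G w := by
      refine Measurable.mul ?_ hG
      refine measurable_expNeg.comp (Monotone.measurable fun w w' h => ?_)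
      exact lintegral_mono_set (Ioc_subset_Ioc_right h)
    rw [← lintegral_const_mul _ hmeas, hAdef, ← Measure.restrict_restrict hhm.compl,
      ← lintegral_indicator hhm.compl]
    refine lintegral_congr fun w => ?_
    simp only [indicator_apply]
    split_ifs
    · rw [hE]
      calc _ = (e w * ENNReal.ofReal (Real.exp w)) *
            (z * (expNeg (∫⁻ x in Ioc 0 w, G x) * G w)) := by ring
        _ = _ := by rw [hee, one_mul]
    · simp
  have h2 : ∫⁻ w in Ioi (0 : ℝ), e w * hit.indicator (fun _ => b) w ≤
      z * expNeg (∫⁻ x in A, G x) := by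
    have hsub : hit ⊆ Ioi 0 := by
      rw [hhit]
      rintro w ⟨y, hy, hyw, -⟩
      exact lt_of_le_of_lt (by exact_mod_cast hy) hyw
    calc ∫⁻ w in Ioi (0 : ℝ), e w * hit.indicator (fun _ => b) w
        = (∫⁻ w in hit, e w) * b := by
          rw [← lintegral_mul_const _ hem, ← inter_eq_left.2 hsub,
            ← Measure.restrict_restrict hhm, ← lintegral_indicator hhm, inter_eq_left.2 hsub]
          refine lintegral_congr fun w => ?_
          simp only [indicator_apply]
          split_ifs <;> simp
      _ = (⨆ y : {y : ℚ // 0 ≤ y ∧ b ≤ z * E y}, e y.1) * b := by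
          congr 1
          rw [hhit', setLIntegral_iUnion_of_directed]
          · exact iSup_congr fun y => lintegral_exp_neg_Ioi _
          · refine Antitone.directed_le
              (f := fun y : {y : ℚ // 0 ≤ y ∧ b ≤ z * E y} => Ioi (y.1 : ℝ)) fun y y' h => ?_
            exact Ioi_subset_Ioi (by exact_mod_cast h)
      _ ≤ z * expNeg (∫⁻ x in A, G x) := by
          rw [ENNReal.iSup_mul]
          refine iSup_le fun ⟨y, hy0, hy⟩ => ?_
          have hsubA : A ⊆ Ioc 0 (y : ℝ) := by
            rintro w ⟨hw, hw0⟩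
            refine ⟨hw0, not_lt.1 fun hlt => hw ?_⟩
            rw [hhit]
            exact ⟨y, hy0, hlt, hy⟩
          calc e y * b ≤ e y * (z * E y) := by gcongr
            _ = (e y * ENNReal.ofReal (Real.exp y)) * (z * expNeg (∫⁻ x in Ioc 0 (y : ℝ), G x)) := by
                rw [hE]; ring
            _ = z * expNeg (∫⁻ x in Ioc 0 (y : ℝ), G x) := by rw [hee, one_mul]
            _ ≤ z * expNeg (∫⁻ x in A, G x) := by
                gcongr
                exact expNeg_antitone (lintegral_mono_set hsubA)
  calc _ = (∫⁻ w in Ioi (0 : ℝ), e w * hit.indicator (fun _ => b) w) +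
        ∫⁻ w in Ioi (0 : ℝ), e w * hitᶜ.indicator (fun w => z * (E w * G w)) w := by
        have : Measurable fun w => e w * hit.indicator (fun _ => b) w :=
          hem.mul (measurable_const.indicator hhm)
        rw [← lintegral_add_left this]
        exact lintegral_congr fun w => mul_add _ _ _
    _ ≤ z * expNeg (∫⁻ x in A, G x) + z * ∫⁻ w in A, expNeg (∫⁻ x in Ioc 0 w, G x) * G w := by
        rw [h1]
        gcongr
    _ = z * ((∫⁻ w in A, expNeg (∫⁻ x in Ioc 0 w, G x) * G w) + expNeg (∫⁻ x in A, G x)) := by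
        ring
    _ ≤ z * 1 := by gcongr
    _ = z := mul_one z

/-! ### The maximal inequality for a multiplicative process driven by Poisson points -/

theorem lintegral_expMeasure_one (g : ℝ → ℝ≥0∞) :
    ∫⁻ y, g y ∂(expMeasure 1) = ∫⁻ y in Ioi (0 : ℝ), ENNReal.ofReal (Real.exp (-y)) * g y := by
  have h : expMeasure 1 = (volume.restrict (Ici (0 : ℝ))).withDensity
      fun y => ENNReal.ofReal (Real.exp (-y)) := by
    rw [← withDensity_indicator measurableSet_Ici]
    unfold expMeasure gammaMeasure
    congr 1
    ext y
    change exponentialPDF 1 y = _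
    rw [exponentialPDF_eq]
    by_cases hy : 0 ≤ y
    · simp [hy]
    · simp [hy]
  rw [h, lintegral_withDensity_eq_lintegral_mul_non_measurable₀ _ (by fun_prop)
    (Eventually.of_forall fun _ => ENNReal.ofReal_lt_top), setLIntegral_congr Ioi_ae_eq_Ici.symm]
  rfl

section Past

variable {Ω : Type*}

/-- The σ-algebra generated by the first `k` interarrival times and their marks. -/
@[reducible]
def pastSigma (w : ℕ → Ω → ℝ) (u : ℕ → Ω → unitInterval) (k : ℕ) : MeasurableSpace Ω :=
  ⨆ j ∈ Iio k, MeasurableSpace.comap (fun ω => (w j ω, u j ω)) inferInstance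

/-- A copy of the sample space that carries the σ-algebra `pastSigma w u k`: a measurable function
on it is a measurable function of the first `k` interarrival times and marks. -/
def PastSpace (_w : ℕ → Ω → ℝ) (_u : ℕ → Ω → unitInterval) (_k : ℕ) : Type _ := Ω

instance (w : ℕ → Ω → ℝ) (u : ℕ → Ω → unitInterval) (k : ℕ) : MeasurableSpace (PastSpace w u k) :=
  pastSigma w u k

/-- The identity, as a map from the sample space to its copy. -/
def toPast (w : ℕ → Ω → ℝ) (u : ℕ → Ω → unitInterval) (k : ℕ) (ω : Ω) : PastSpace w u k := ω

variable {w : ℕ → Ω → ℝ} {u : ℕ → Ω → unitInterval}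

theorem comap_le_pastSigma {j k : ℕ} (h : j < k) :
    MeasurableSpace.comap (fun ω => (w j ω, u j ω)) inferInstance ≤ pastSigma w u k :=
  le_iSup₂_of_le j h le_rfl

theorem pastSigma_mono {j k : ℕ} (h : j ≤ k) : pastSigma w u j ≤ pastSigma w u k :=
  iSup₂_le fun _ hi => comap_le_pastSigma (lt_of_lt_of_le hi h)

theorem measurable_past_mark {j k : ℕ} (h : j < k) :
    Measurable fun ω : PastSpace w u k => (w j ω, u j ω) :=
  measurable_iff_comap_le.2 (comap_le_pastSigma h)

theorem measurable_past_shift {j k : ℕ} (h : j ≤ k) :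
    Measurable fun ω : PastSpace w u k => toPast w u j ω :=
  fun _ hs => pastSigma_mono h _ hs

/-- The rate at which a multiplicative process with factors `f` grows after the `k`-th point. -/
noncomputable def meanFactor (f : ∀ k, PastSpace w u k → ℝ → unitInterval → ℝ≥0∞) (k : ℕ)
    (ω : PastSpace w u k) (y : ℝ) : ℝ≥0∞ :=
  ∫⁻ v, f k ω y v

/-- The compensating factor `e^{y - ∫_0^y ∫ f}` accumulated in the time `y` after the `k`-th
point. -/
noncomputable def compensatingFactor (f : ∀ k, PastSpace w u k → ℝ → unitInterval → ℝ≥0∞) (k : ℕ)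
    (ω : PastSpace w u k) (y : ℝ) : ℝ≥0∞ :=
  ENNReal.ofReal (Real.exp y) * expNeg (∫⁻ x in Ioc 0 y, meanFactor f k ω x)

/-- The values, just after the `k`-th point, of the multiplicative process that is multiplied by
`f k` at the `k`-th point and compensated between the points. -/
noncomputable def multiplicativeChain (f : ∀ k, PastSpace w u k → ℝ → unitInterval → ℝ≥0∞) :
    ℕ → Ω → ℝ≥0∞
  | 0, _ => 1
  | k + 1, ω => multiplicativeChain f k ω *
      (compensatingFactor f k ω (w k ω) * f k ω (w k ω) (u k ω))

/-- The event that the multiplicative process reaches the level `b` at a rational time after one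
of the first `k` points. -/
def reachesBefore (f : ∀ k, PastSpace w u k → ℝ → unitInterval → ℝ≥0∞) (b : ℝ≥0∞) (k : ℕ) :
    Set Ω :=
  {ω | ∃ j < k, ∃ y : ℚ, 0 ≤ y ∧ (y : ℝ) < w j ω ∧
    b ≤ multiplicativeChain f j ω * compensatingFactor f j ω y}

section Chain

variable {f : ∀ k, PastSpace w u k → ℝ → unitInterval → ℝ≥0∞}
  (hf : ∀ k, Measurable fun p : PastSpace w u k × ℝ × unitInterval => f k p.1 p.2.1 p.2.2)
include hf

theorem measurable_meanFactor (k : ℕ) :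
    Measurable fun p : PastSpace w u k × ℝ => meanFactor f k p.1 p.2 := by
  refine Measurable.lintegral_prod_right' (f := fun p : (PastSpace w u k × ℝ) × unitInterval =>
    f k p.1.1 p.1.2 p.2) ?_
  exact (hf k).comp (by fun_prop : Measurable
    fun p : (PastSpace w u k × ℝ) × unitInterval => (p.1.1, p.1.2, p.2))

theorem measurable_compensatingFactor (k : ℕ) :
    Measurable fun p : PastSpace w u k × ℝ => compensatingFactor f k p.1 p.2 := by
  classical
  have h : Measurable fun p : PastSpace w u k × ℝ => ∫⁻ x in Ioc 0 p.2, meanFactor f k p.1 x := by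
    have : ∀ p : PastSpace w u k × ℝ, ∫⁻ x in Ioc 0 p.2, meanFactor f k p.1 x =
        ∫⁻ x, {r : (PastSpace w u k × ℝ) × ℝ | r.2 ∈ Ioc 0 r.1.2}.indicator
          (fun r => meanFactor f k r.1.1 r.2) (p, x) := fun p => by
      rw [← lintegral_indicator measurableSet_Ioc]
      rfl
    simp_rw [this]
    refine Measurable.lintegral_prod_right' ?_
    refine Measurable.indicator ?_ ?_
    · exact (measurable_meanFactor hf k).comp (by fun_prop :
        Measurable fun r : (PastSpace w u k × ℝ) × ℝ => (r.1.1, r.2))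
    · exact (measurableSet_lt measurable_const measurable_snd).inter
        (measurableSet_le measurable_snd (by fun_prop))
  exact (by fun_prop : Measurable fun p : PastSpace w u k × ℝ =>
    ENNReal.ofReal (Real.exp p.2)).mul (measurable_expNeg.comp h)

theorem measurable_multiplicativeChain (k : ℕ) :
    Measurable fun ω : PastSpace w u k => multiplicativeChain f k ω := by
  induction k with
  | zero => exact measurable_const
  | succ k ih =>
    have hs := measurable_past_shift (w := w) (u := u) k.le_succ
    have hm := measurable_past_mark (w := w) (u := u) k.lt_succ_self
    refine (ih.comp hs).mul (Measurable.mul ?_ ?_)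
    · exact (measurable_compensatingFactor hf k).comp (hs.prodMk hm.fst)
    · exact (hf k).comp (hs.prodMk hm)

theorem measurableSet_reachesBefore (b : ℝ≥0∞) (k : ℕ) :
    MeasurableSet (toPast w u k ⁻¹' reachesBefore f b k : Set (PastSpace w u k)) := by
  have : (toPast w u k ⁻¹' reachesBefore f b k : Set (PastSpace w u k)) =
      ⋃ j : ℕ, ⋃ _ : j < k, ⋃ y : ℚ, ⋃ _ : 0 ≤ y, {ω : PastSpace w u k | (y : ℝ) < w j ω} ∩
        {ω : PastSpace w u k | b ≤ multiplicativeChain f j ω * compensatingFactor f j ω y} := by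
    ext ω
    simp only [mem_iUnion, exists_prop]
    rfl
  rw [this]
  refine MeasurableSet.iUnion fun j => MeasurableSet.iUnion fun hj => MeasurableSet.iUnion fun y =>
    MeasurableSet.iUnion fun _ => MeasurableSet.inter ?_ ?_
  · exact measurableSet_lt measurable_const (measurable_past_mark hj).fst
  · have hs := measurable_past_shift (w := w) (u := u) hj.le
    refine measurableSet_le measurable_const (Measurable.mul ?_ ?_)
    · exact (measurable_multiplicativeChain hf j).comp hs
    · exact (measurable_compensatingFactor hf j).comp (hs.prodMk measurable_const)

end Chain

variable [mΩ : MeasurableSpace Ω]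

/-- The points `w_0, w_0 + w_1, …` with the marks `u_0, u_1, …` form a Poisson process on
`[0,∞) × [0,1]` with unit intensity. -/
structure IsMarkedPoisson (w : ℕ → Ω → ℝ) (u : ℕ → Ω → unitInterval) (P : Measure Ω) : Prop where
  measurable_w : ∀ i, Measurable (w i)
  measurable_u : ∀ i, Measurable (u i)
  law_w : ∀ i, HasLaw (w i) (expMeasure 1) P
  law_u : ∀ i, HasLaw (u i) (volume : Measure unitInterval) P
  indep_w_u : ∀ i, IndepFun (w i) (u i) P
  indep : iIndepFun (fun i ω => (w i ω, u i ω)) P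

variable {P : Measure Ω}

namespace IsMarkedPoisson

theorem pastSigma_le (H : IsMarkedPoisson w u P) (k : ℕ) : pastSigma w u k ≤ mΩ :=
  iSup₂_le fun i _ => ((H.measurable_w i).prodMk (H.measurable_u i)).comap_le

theorem measurable_toPast (H : IsMarkedPoisson w u P) (k : ℕ) : Measurable (toPast w u k) :=
  fun _ hs => H.pastSigma_le k _ hs

variable [IsProbabilityMeasure P]

/-- The next point and its mark are independent of the past. -/
theorem lintegral_next (H : IsMarkedPoisson w u P) (k : ℕ)
    {Ψ : PastSpace w u k → ℝ → unitInterval → ℝ≥0∞}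
    (hΨ : Measurable fun p : PastSpace w u k × ℝ × unitInterval => Ψ p.1 p.2.1 p.2.2) :
    ∫⁻ ω, Ψ ω (w k ω) (u k ω) ∂P =
      ∫⁻ ω, (∫⁻ y in Ioi (0 : ℝ), ENNReal.ofReal (Real.exp (-y)) * ∫⁻ v, Ψ ω y v) ∂P := by
  have hp := H.measurable_toPast k
  have hwu := (H.measurable_w k).prodMk (H.measurable_u k)
  have hind : IndepFun (toPast w u k) (fun ω => (w k ω, u k ω)) P := by
    have h := indep_iSup_of_disjoint (μ := P)
      (m := fun i => MeasurableSpace.comap (fun ω => (w i ω, u i ω)) inferInstance)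
      (fun i => ((H.measurable_w i).prodMk (H.measurable_u i)).comap_le) H.indep
      (S := Iio k) (T := {k}) (by simp)
    rw [IndepFun_iff_Indep]
    have h1 : MeasurableSpace.comap (toPast w u k) inferInstance = pastSigma w u k :=
      MeasurableSpace.comap_id
    rw [h1]
    simpa [pastSigma] using h
  have hlaw : P.map (fun ω => (w k ω, u k ω)) = (expMeasure 1).prod volume := by
    rw [(H.indep_w_u k).map_prod_eq_prod_map_map (H.measurable_w k).aemeasurable
      (H.measurable_u k).aemeasurable, (H.law_w k).map_eq, (H.law_u k).map_eq]
  have hmap := hind.map_prod_eq_prod_map_map hp.aemeasurable hwu.aemeasurable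
  rw [hlaw] at hmap
  have hpr : IsProbabilityMeasure (expMeasure 1) := isProbabilityMeasure_expMeasure one_pos
  have hpr' : IsProbabilityMeasure (P.map (toPast w u k)) :=
    Measure.isProbabilityMeasure_map hp.aemeasurable
  calc ∫⁻ ω, Ψ ω (w k ω) (u k ω) ∂P
      = ∫⁻ p, Ψ p.1 p.2.1 p.2.2 ∂(P.map fun ω => (toPast w u k ω, (w k ω, u k ω))) :=
        (lintegral_map hΨ (hp.prodMk hwu)).symm
    _ = ∫⁻ ω, ∫⁻ q, Ψ ω q.1 q.2 ∂((expMeasure 1).prod volume) ∂(P.map (toPast w u k)) := by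
        rw [hmap, lintegral_prod _ hΨ.aemeasurable]
    _ = ∫⁻ ω, ∫⁻ q, Ψ (toPast w u k ω) q.1 q.2 ∂((expMeasure 1).prod volume) ∂P :=
        lintegral_map hΨ.lintegral_prod_right' hp
    _ = ∫⁻ ω, (∫⁻ y in Ioi (0 : ℝ), ENNReal.ofReal (Real.exp (-y)) * ∫⁻ v, Ψ ω y v) ∂P := by
        refine lintegral_congr fun ω => ?_
        have hm : Measurable fun q : ℝ × unitInterval => Ψ (toPast w u k ω) q.1 q.2 :=
          hΨ.comp measurable_prodMk_left
        rw [lintegral_prod _ hm.aemeasurable, lintegral_expMeasure_one]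
        rfl

end IsMarkedPoisson

section Chain

variable {f : ∀ k, PastSpace w u k → ℝ → unitInterval → ℝ≥0∞}
  (hf : ∀ k, Measurable fun p : PastSpace w u k × ℝ × unitInterval => f k p.1 p.2.1 p.2.2)
include hf

variable [IsProbabilityMeasure P]

/-- The multiplicative process, stopped at the level `b`, is a supermartingale. -/
theorem lintegral_stopped_le_one (H : IsMarkedPoisson w u P) (b : ℝ≥0∞) (k : ℕ) :
    ∫⁻ ω, (reachesBefore f b k).indicator (fun _ => b) ω +
      (reachesBefore f b k)ᶜ.indicator (multiplicativeChain f k) ω ∂P ≤ 1 := by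
  classical
  induction k with
  | zero =>
    have : reachesBefore f b 0 = ∅ := by
      ext; simp [reachesBefore]
    simp [this, multiplicativeChain]
  | succ k ih =>
    refine le_trans ?_ ih
    set R := reachesBefore f b k with hR
    set hit : PastSpace w u k → Set ℝ := fun ω => {y' | ∃ y : ℚ, 0 ≤ y ∧ (y : ℝ) < y' ∧
      b ≤ multiplicativeChain f k ω * compensatingFactor f k ω y} with hhit
    set Ψ : PastSpace w u k → ℝ → unitInterval → ℝ≥0∞ := fun ω y v =>
      R.indicator (fun _ => b) ω + Rᶜ.indicator (fun ω => (hit ω).indicator (fun _ => b) y +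
        (hit ω)ᶜ.indicator (fun y => multiplicativeChain f k ω *
          (compensatingFactor f k ω y * f k ω y v)) y) ω with hΨ
    have hRm : MeasurableSet (toPast w u k ⁻¹' R : Set (PastSpace w u k)) :=
      measurableSet_reachesBefore hf b k
    have hRm' : MeasurableSet {p : PastSpace w u k × ℝ × unitInterval | p.1 ∈ R} :=
      hRm.preimage measurable_fst
    have hZ := (measurable_multiplicativeChain hf k)
    have hE := (measurable_compensatingFactor hf k)
    have hHm : MeasurableSet {p : PastSpace w u k × ℝ × unitInterval | p.2.1 ∈ hit p.1} := by
      have : {p : PastSpace w u k × ℝ × unitInterval | p.2.1 ∈ hit p.1} =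
          ⋃ y : ℚ, ⋃ _ : 0 ≤ y, {p | (y : ℝ) < p.2.1} ∩
            {p | b ≤ multiplicativeChain f k p.1 * compensatingFactor f k p.1 y} := by
        ext p
        simp only [mem_iUnion, exists_prop]
        rfl
      rw [this]
      refine MeasurableSet.iUnion fun y => MeasurableSet.iUnion fun _ => MeasurableSet.inter ?_ ?_
      · exact measurableSet_lt measurable_const (by fun_prop)
      · refine measurableSet_le measurable_const (Measurable.mul (hZ.comp measurable_fst) ?_)
        exact hE.comp (measurable_fst.prodMk measurable_const)
    have hΨm : Measurable fun p : PastSpace w u k × ℝ × unitInterval => Ψ p.1 p.2.1 p.2.2 := by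
      refine Measurable.add ?_ ?_
      · exact Measurable.indicator measurable_const hRm'
      · refine Measurable.indicator (s := {p | p.1 ∈ R}ᶜ)
          (f := fun p : PastSpace w u k × ℝ × unitInterval =>
            (hit p.1).indicator (fun _ => b) p.2.1 + (hit p.1)ᶜ.indicator (fun y =>
              multiplicativeChain f k p.1 * (compensatingFactor f k p.1 y * f k p.1 y p.2.2)) p.2.1)
          (Measurable.add ?_ ?_) hRm'.compl
        · exact Measurable.indicator measurable_const hHm
        · refine Measurable.indicator (s := {p | p.2.1 ∈ hit p.1}ᶜ)
            (f := fun p : PastSpace w u k × ℝ × unitInterval =>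
              multiplicativeChain f k p.1 * (compensatingFactor f k p.1 p.2.1 *
                f k p.1 p.2.1 p.2.2)) ?_ hHm.compl
          exact (hZ.comp measurable_fst).mul
            ((hE.comp (measurable_fst.prodMk measurable_snd.fst)).mul (hf k))
    have hsucc : reachesBefore f b (k + 1) = R ∪ {ω | w k ω ∈ hit ω} := by
      ext ω
      simp only [reachesBefore, hR, hhit, mem_ofPred_eq, mem_union, Nat.lt_succ_iff_lt_or_eq,
        or_and_right, exists_or, exists_eq_left]
    have h1 : ∀ ω, (reachesBefore f b (k + 1)).indicator (fun _ => b) ω +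
        (reachesBefore f b (k + 1))ᶜ.indicator (multiplicativeChain f (k + 1)) ω =
        Ψ ω (w k ω) (u k ω) := by
      intro ω
      simp only [hΨ, hsucc, indicator_apply, mem_compl_iff, mem_union, mem_ofPred_eq,
        multiplicativeChain]
      by_cases h1 : ω ∈ R <;> by_cases h2 : w k ω ∈ hit ω <;> simp [h1, h2]
    simp_rw [h1]
    rw [H.lintegral_next k hΨm]
    refine lintegral_mono fun ω => ?_
    by_cases hω : ω ∈ R
    · simp only [hΨ, indicator_of_mem hω, indicator_of_notMem (notMem_compl_iff.2 hω), add_zero,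
        lintegral_const, measure_univ, mul_one]
      rw [lintegral_mul_const _ (by fun_prop), lintegral_exp_neg_Ioi]
      simp
    · simp only [hΨ, indicator_of_notMem hω, indicator_of_mem (mem_compl hω), zero_add]
      refine le_trans (le_of_eq ?_) (lintegral_step_le (G := meanFactor f k ω)
        ((measurable_meanFactor hf k).comp measurable_prodMk_left) (multiplicativeChain f k ω) b
        (E := compensatingFactor f k ω) rfl (hit := hit ω) rfl)
      refine lintegral_congr fun y => ?_
      congr 1
      have hfm : Measurable (f k ω y) :=
        (hf k).comp (measurable_prodMk_left.comp measurable_prodMk_left)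
      by_cases hy : y ∈ hit ω
      · simp [hy]
      · simp only [indicator_of_notMem hy, indicator_of_mem (mem_compl hy), zero_add]
        rw [lintegral_const_mul _ (hfm.const_mul _), lintegral_const_mul _ hfm]
        rfl

/-- The maximal inequality for the multiplicative process. -/
theorem measure_reaches_le (H : IsMarkedPoisson w u P) {b : ℝ≥0∞} (hb : b ≠ 0) (hb' : b ≠ ∞) :
    P {ω | ∃ k, ∃ y : ℝ, 0 ≤ y ∧ y < w k ω ∧
      b ≤ multiplicativeChain f k ω * compensatingFactor f k ω y} ≤ b⁻¹ := by
  have hrat : ∀ c : ℝ≥0∞, c ≠ 0 → c ≠ ∞ → P (⋃ k, reachesBefore f c k) ≤ c⁻¹ := by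
    intro c hc hc'
    have hmono : Monotone (reachesBefore f c) := fun k k' h ω ⟨j, hj, hy⟩ => ⟨j, hj.trans_le h, hy⟩
    rw [hmono.measure_iUnion]
    refine iSup_le fun k => ?_
    have hm : MeasurableSet (reachesBefore f c k) :=
      H.pastSigma_le k _ (measurableSet_reachesBefore hf c k)
    rw [ENNReal.le_inv_iff_mul_le]
    calc P (reachesBefore f c k) * c
        = ∫⁻ ω, (reachesBefore f c k).indicator (fun _ => c) ω ∂P := by
          rw [lintegral_indicator hm, setLIntegral_const, mul_comm]
      _ ≤ _ := lintegral_mono fun ω => le_self_add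
      _ ≤ 1 := lintegral_stopped_le_one hf H c k
  have key : ∀ c : ℝ≥0∞, c ≠ 0 → c < b → P {ω | ∃ k, ∃ y : ℝ, 0 ≤ y ∧ y < w k ω ∧
      b ≤ multiplicativeChain f k ω * compensatingFactor f k ω y} ≤ c⁻¹ := by
    intro c hc hcb
    refine le_trans (measure_mono ?_) (hrat c hc (hcb.trans_le le_top).ne)
    rintro ω ⟨k, y, hy0, hyw, hy⟩
    refine mem_iUnion.2 ⟨k + 1, k, k.lt_succ_self, ?_⟩
    rcases hy0.eq_or_lt with rfl | hy0
    · exact ⟨0, le_rfl, by simpa using hyw, by simpa using hcb.le.trans hy⟩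
    -- The compensating factor loses at most `e^{y - y'}` between a rational `y' < y` and `y`.
    have hcont : Tendsto (fun y' : ℝ => ENNReal.ofReal (Real.exp (y' - y)) * b)
        (𝓝[<] y) (𝓝 b) := by
      have h1 : Tendsto (fun y' : ℝ => ENNReal.ofReal (Real.exp (y' - y))) (𝓝 y) (𝓝 1) := by
        have : Continuous fun y' : ℝ => ENNReal.ofReal (Real.exp (y' - y)) :=
          ENNReal.continuous_ofReal.comp (by fun_prop)
        simpa using this.tendsto y
      have := ENNReal.Tendsto.mul_const (b := b) h1 (Or.inr hb')
      rw [one_mul] at this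
      exact this.mono_left nhdsWithin_le_nhds
    have hev : ∀ᶠ y' in 𝓝[<] y, c < ENNReal.ofReal (Real.exp (y' - y)) * b ∧ 0 < y' :=
      (hcont.eventually_const_lt hcb).and (nhdsWithin_le_nhds (lt_mem_nhds hy0))
    obtain ⟨z, hzy, hz⟩ := (mem_nhdsLT_iff_exists_Ioo_subset' hy0).1 hev
    obtain ⟨r, hr1, hr2⟩ := exists_rat_btwn (mem_Iio.1 hzy)
    obtain ⟨hr3, hr4⟩ := hz ⟨hr1, hr2⟩
    refine ⟨r, by exact_mod_cast hr4.le, hr2.trans hyw, hr3.le.trans ?_⟩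
    calc ENNReal.ofReal (Real.exp (r - y)) * b
        ≤ ENNReal.ofReal (Real.exp (r - y)) *
          (multiplicativeChain f k ω * compensatingFactor f k ω y) := by gcongr
      _ = multiplicativeChain f k ω * ((ENNReal.ofReal (Real.exp (r - y)) *
          ENNReal.ofReal (Real.exp y)) * expNeg (∫⁻ x in Ioc 0 y, meanFactor f k ω x)) := by
          unfold compensatingFactor; ring
      _ ≤ multiplicativeChain f k ω * compensatingFactor f k ω r := by
          rw [← ENNReal.ofReal_mul (Real.exp_pos _).le, ← Real.exp_add, sub_add_cancel]
          unfold compensatingFactor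
          gcongr
          exact expNeg_antitone (lintegral_mono_set (Ioc_subset_Ioc_right hr2.le))
  have hb0 : 0 < b := pos_iff_ne_zero.2 hb
  have hlim : Tendsto (fun c : ℝ≥0∞ => c⁻¹) (𝓝[<] b) (𝓝 b⁻¹) :=
    (tendsto_inv_iff.2 tendsto_id).mono_left nhdsWithin_le_nhds
  have : (𝓝[<] b).NeBot := nhdsLT_neBot_of_exists_lt ⟨0, hb0⟩
  refine ge_of_tendsto hlim ?_
  filter_upwards [self_mem_nhdsWithin, nhdsWithin_le_nhds (lt_mem_nhds hb0)] with c hc hc0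
  exact key c hc0.ne' hc

end Chain

end Past

/-! ### Time integrals of adapted processes -/

theorem integral_mul_condExp {Ω : Type*} {m : MeasurableSpace Ω} [mΩ : MeasurableSpace Ω]
    {P : Measure Ω} [IsProbabilityMeasure P] (hm : m ≤ mΩ) {f g : Ω → ℝ}
    (hg : StronglyMeasurable[m] g) (hfg : Integrable (f * g) P) (hf : Integrable f P) :
    ∫ ω, P[f|m] ω * g ω ∂P = ∫ ω, f ω * g ω ∂P := by
  have h := condExp_mul_of_stronglyMeasurable_right hg hfg hf
  calc ∫ ω, P[f|m] ω * g ω ∂P = ∫ ω, P[f * g|m] ω ∂P := (integral_congr_ae h).symm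
    _ = ∫ ω, f ω * g ω ∂P := integral_condExp hm

/-- The time integral of a bounded measurable process, all of whose values are `m`-measurable, is
`m`-measurable up to a null set. (It need not be `m`-measurable, because the process need not be
measurable for the product of the Borel σ-algebra and `m`.) -/
theorem exists_measurable_integral_ae_eq {Ω T : Type*} {m : MeasurableSpace Ω}
    [mΩ : MeasurableSpace Ω] [MeasurableSpace T] {P : Measure Ω} [IsProbabilityMeasure P]
    (hm : m ≤ mΩ) (ν : Measure T) [IsFiniteMeasure ν] {F : T → Ω → ℝ} (hF : Measurable (Function.uncurry F)) {C : ℝ}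
    (hC : ∀ t ω, |F t ω| ≤ C) (hFm : ∀ t, Measurable[m] (F t)) :
    ∃ g : Ω → ℝ, Measurable[m] g ∧ (fun ω => ∫ t, F t ω ∂ν) =ᵐ[P] g := by
  classical
  set I : Ω → ℝ := fun ω => ∫ t, F t ω ∂ν with hI
  have hF' : Measurable (fun p : Ω × T => F p.2 p.1) := hF.comp measurable_swap
  have hIm : StronglyMeasurable[mΩ] I :=
    StronglyMeasurable.integral_prod_right (f := fun ω t => F t ω) hF'.stronglyMeasurable
  have hIb : ∀ ω, ‖I ω‖ ≤ C * ν.real univ := fun ω =>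
    norm_integral_le_of_norm_le_const (Eventually.of_forall fun t => hC t ω)
  have hIint : Integrable I P := Integrable.of_bound hIm.aestronglyMeasurable _
    (Eventually.of_forall hIb)
  refine ⟨P[I|m], stronglyMeasurable_condExp.measurable, ?_⟩
  refine Integrable.ae_eq_of_forall_setIntegral_eq _ _ hIint integrable_condExp fun A hA _ => ?_
  set a : Ω → ℝ := A.indicator fun _ => 1 with ha
  have hab : ∀ ω, ‖a ω‖ ≤ 1 := fun ω => by
    simp only [ha, indicator_apply]; split_ifs <;> simp
  have ham : StronglyMeasurable[mΩ] a := stronglyMeasurable_const.indicator hA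
  have haint : Integrable a P := Integrable.of_bound ham.aestronglyMeasurable 1
    (Eventually.of_forall hab)
  have hind : ∀ f : Ω → ℝ, ∫ ω in A, f ω ∂P = ∫ ω, a ω * f ω ∂P := fun f => by
    rw [← integral_indicator hA]
    refine integral_congr_ae (Eventually.of_forall fun ω => ?_)
    simp only [ha, indicator_apply]
    split_ifs <;> simp
  set e : Ω → ℝ := P[a|m] with he
  have hem : StronglyMeasurable[m] e := stronglyMeasurable_condExp
  have heint : Integrable e P := integrable_condExp
  have h1 : ∫ ω, a ω * P[I|m] ω ∂P = ∫ ω, e ω * I ω ∂P := by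
    have h2 : Integrable (a * P[I|m]) P := by
      refine (integrable_condExp (m := m) (f := I)).bdd_mul (c := 1) ham.aestronglyMeasurable
        (Eventually.of_forall hab)
    have h3 : Integrable (I * e) P := heint.bdd_mul hIm.aestronglyMeasurable
      (Eventually.of_forall hIb)
    calc ∫ ω, a ω * P[I|m] ω ∂P = ∫ ω, e ω * P[I|m] ω ∂P :=
          (integral_mul_condExp hm stronglyMeasurable_condExp h2 haint).symm
      _ = ∫ ω, P[I|m] ω * e ω ∂P := by simp_rw [mul_comm]
      _ = ∫ ω, I ω * e ω ∂P := integral_mul_condExp hm hem h3 hIint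
      _ = ∫ ω, e ω * I ω ∂P := by simp_rw [mul_comm]
  have hprod : ∀ f : Ω → ℝ, StronglyMeasurable[mΩ] f → Integrable f P →
      ∫ ω, f ω * I ω ∂P = ∫ t, ∫ ω, f ω * F t ω ∂P ∂ν := by
    intro f _ hfi
    have hint : Integrable (Function.uncurry fun ω t => f ω * F t ω) (P.prod ν) :=
      (hfi.comp_fst ν).mul_bdd (c := C) hF'.aestronglyMeasurable
        (Eventually.of_forall fun p => hC p.2 p.1)
    rw [← integral_integral_swap hint]
    refine integral_congr_ae (Eventually.of_forall fun ω => ?_)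
    exact (integral_const_mul _ _).symm
  rw [hind, hind, h1, hprod a ham haint, hprod e (hem.mono hm) heint]
  refine integral_congr_ae (Eventually.of_forall fun t => ?_)
  refine (integral_mul_condExp hm (hFm t).stronglyMeasurable ?_ haint).symm
  exact haint.mul_bdd (c := C) ((hFm t).mono hm le_rfl).aestronglyMeasurable
    (Eventually.of_forall fun ω => hC t ω)

/-! ### The cumulative rate and its inverse -/

namespace HybridJump

theorem timeMeasure_Ioc (s t : ℝ≥0) : timeMeasure (Ioc s t) = ENNReal.ofReal ((t : ℝ) - s) := by
  rw [timeMeasure, Measure.map_apply measurable_real_toNNReal measurableSet_Ioc,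
    Measure.restrict_apply (measurable_real_toNNReal measurableSet_Ioc), ← Real.volume_Ioc]
  congr 1
  ext x
  simp only [mem_inter_iff, mem_preimage, mem_Ioc, mem_Ici]
  constructor
  · rintro ⟨⟨h1, h2⟩, h3⟩
    exact ⟨Real.lt_toNNReal_iff_coe_lt.1 h1, (Real.toNNReal_le_iff_le_coe).1 h2⟩
  · rintro ⟨h1, h2⟩
    exact ⟨⟨Real.lt_toNNReal_iff_coe_lt.2 h1, Real.toNNReal_le_iff_le_coe.2 h2⟩,
      s.coe_nonneg.trans h1.le⟩

theorem timeMeasure_singleton (s : ℝ≥0) : timeMeasure {s} = 0 := by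
  rw [timeMeasure, Measure.map_apply measurable_real_toNNReal (measurableSet_singleton s),
    Measure.restrict_apply (measurable_real_toNNReal (measurableSet_singleton s))]
  refine measure_mono_null (t := {(s : ℝ)}) ?_ (measure_singleton _)
  rintro x ⟨h1, h2⟩
  have : x.toNNReal = s := h1
  simp [← this, Real.coe_toNNReal x h2]

theorem timeMeasure_Iic (t : ℝ≥0) : timeMeasure (Iic t) = t := by
  have h : Iic t = {0} ∪ Ioc 0 t := by
    ext x
    simp only [mem_Iic, singleton_union, mem_insert_iff, mem_Ioc, pos_iff_ne_zero]
    constructor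
    · intro h
      by_cases hx : x = 0
      · exact Or.inl hx
      · exact Or.inr ⟨hx, h⟩
    · rintro (rfl | h)
      · exact zero_le
      · exact h.2
  apply le_antisymm
  · calc timeMeasure (Iic t) ≤ timeMeasure {0} + timeMeasure (Ioc 0 t) := by
          rw [h]; exact measure_union_le _ _
      _ = t := by rw [timeMeasure_singleton, timeMeasure_Ioc]; simp
  · calc (t : ℝ≥0∞) = timeMeasure (Ioc 0 t) := by rw [timeMeasure_Ioc]; simp
      _ ≤ timeMeasure (Iic t) := measure_mono fun x hx => hx.2

instance (t : ℝ≥0) : IsFiniteMeasure (timeMeasure.restrict (Iic t)) :=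
  ⟨by rw [Measure.restrict_apply_univ, timeMeasure_Iic]; exact ENNReal.coe_lt_top⟩

variable {Ω : Type*}

/-- The time at which the cumulative rate exceeds all values below `v`: the generalized inverse of
the cumulative rate. The jump times are its values at the points of the driving process. -/
noncomputable def inverseRate (q : ℝ≥0 → Ω → ℝ≥0) (v : ℝ) (ω : Ω) : ℝ≥0∞ :=
  ⨆ (r : ℝ≥0) (_ : cumulativeRate q r ω < ENNReal.ofReal v), (r : ℝ≥0∞)

variable {q : ℝ≥0 → Ω → ℝ≥0} {ω : Ω}

theorem inverseRate_mono : Monotone fun v => inverseRate q v ω := fun _ _ h =>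
  iSup_mono fun _ => iSup_mono' fun hr => ⟨hr.trans_le (ENNReal.ofReal_le_ofReal h), le_rfl⟩

theorem le_inverseRate {v : ℝ} {r : ℝ≥0} (h : cumulativeRate q r ω < ENNReal.ofReal v) :
    (r : ℝ≥0∞) ≤ inverseRate q v ω :=
  le_iSup₂ (f := fun (r : ℝ≥0) (_ : cumulativeRate q r ω < ENNReal.ofReal v) => (r : ℝ≥0∞)) r h

theorem exists_lt_of_lt_inverseRate {v : ℝ} {x : ℝ≥0∞} (h : x < inverseRate q v ω) :
    ∃ r : ℝ≥0, x < r ∧ cumulativeRate q r ω < ENNReal.ofReal v := by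
  obtain ⟨r, hr⟩ := lt_iSup_iff.1 h
  obtain ⟨h1, h2⟩ := lt_iSup_iff.1 hr
  exact ⟨r, h2, h1⟩

theorem cumulativeRate_lt_of_lt_inverseRate {v : ℝ} {s : ℝ≥0}
    (h : (s : ℝ≥0∞) < inverseRate q v ω) :
    cumulativeRate q s ω < ENNReal.ofReal v := by
  obtain ⟨r, h1, h2⟩ := exists_lt_of_lt_inverseRate h
  exact (cumulativeRate_mono q ω (ENNReal.coe_lt_coe.1 h1).le).trans_lt h2

/-- Before the explosion time the transition rate is locally bounded. -/
theorem exists_bound_of_lt_explosionTime {t : ℝ≥0} (ht : (t : ℝ≥0∞) < explosionTime q ω) :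
    ∃ n : ℕ, ∃ t' : ℝ≥0, t < t' ∧ ∀ s < t', q s ω ≤ n := by
  obtain ⟨n, hn⟩ := lt_iSup_iff.1 ht
  obtain ⟨t', h1, h2⟩ := ENNReal.lt_iff_exists_nnreal_btwn.1 hn
  refine ⟨n, t', ENNReal.coe_lt_coe.1 h1, fun s hs => ?_⟩
  by_contra h
  have : (⨅ (t : ℝ≥0) (_ : (n : ℝ≥0) ≤ q t ω), (t : ℝ≥0∞)) ≤ s := iInf₂_le s (not_le.1 h).le
  exact absurd (h2.trans_le this) (not_lt.2 (ENNReal.coe_le_coe.2 hs.le))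

theorem cumulativeRate_le_add {t' : ℝ≥0} {n : ℕ} (hn : ∀ s < t', q s ω ≤ n) {s r : ℝ≥0}
    (hsr : s ≤ r) (hr : r < t') :
    cumulativeRate q r ω ≤ cumulativeRate q s ω + n * ENNReal.ofReal ((r : ℝ) - s) := by
  have h : Iic r = Iic s ∪ Ioc s r := (Iic_union_Ioc_eq_Iic hsr).symm
  unfold cumulativeRate
  calc ∫⁻ x in Iic r, (q x ω : ℝ≥0∞) ∂timeMeasure
      ≤ (∫⁻ x in Iic s, (q x ω : ℝ≥0∞) ∂timeMeasure) +
          ∫⁻ x in Ioc s r, (q x ω : ℝ≥0∞) ∂timeMeasure := by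
        rw [h]; exact lintegral_union_le _ _ _
    _ ≤ (∫⁻ x in Iic s, (q x ω : ℝ≥0∞) ∂timeMeasure) +
          ∫⁻ x in Ioc s r, (n : ℝ≥0∞) ∂timeMeasure := by
        refine add_le_add le_rfl ?_
        refine setLIntegral_mono' measurableSet_Ioc fun x hx => ?_
        exact_mod_cast hn x (hx.2.trans_lt hr)
    _ = _ := by rw [setLIntegral_const, timeMeasure_Ioc]

theorem cumulativeRate_zero : cumulativeRate q 0 ω = 0 := by
  unfold cumulativeRate
  refine setLIntegral_measure_zero _ _ ?_
  simpa using timeMeasure_Iic 0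

variable {s : ℝ≥0}

theorem cumulativeRate_ne_top (hs : (s : ℝ≥0∞) < explosionTime q ω) :
    cumulativeRate q s ω ≠ ∞ := by
  obtain ⟨n, t', ht, hn⟩ := exists_bound_of_lt_explosionTime hs
  have h := cumulativeRate_le_add hn (zero_le (a := s)) ht
  rw [cumulativeRate_zero, zero_add] at h
  exact (h.trans_lt (ENNReal.mul_lt_top (ENNReal.natCast_lt_top n) ENNReal.ofReal_lt_top)).ne

theorem inverseRate_le_iff (hs : (s : ℝ≥0∞) < explosionTime q ω) {v : ℝ} :
    inverseRate q v ω ≤ s ↔ ENNReal.ofReal v ≤ cumulativeRate q s ω := by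
  constructor
  · intro h
    by_contra! hlt
    obtain ⟨n, t', ht, hn⟩ := exists_bound_of_lt_explosionTime hs
    have hcont : Tendsto (fun r : ℝ≥0 => cumulativeRate q s ω + n * ENNReal.ofReal ((r : ℝ) - s))
        (𝓝[>] s) (𝓝 (cumulativeRate q s ω)) := by
      have h1 : Tendsto (fun r : ℝ≥0 => ENNReal.ofReal ((r : ℝ) - s)) (𝓝 s) (𝓝 0) := by
        have : Continuous fun r : ℝ≥0 => ENNReal.ofReal ((r : ℝ) - s) :=
          ENNReal.continuous_ofReal.comp (by fun_prop)
        simpa using this.tendsto s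
      have h2 := (ENNReal.Tendsto.const_mul (a := (n : ℝ≥0∞)) h1
        (Or.inr (ENNReal.natCast_ne_top n))).const_add (cumulativeRate q s ω)
      rw [mul_zero, add_zero] at h2
      exact h2.mono_left nhdsWithin_le_nhds
    have hev := (hcont.eventually_lt_const hlt).and (Ioo_mem_nhdsGT ht)
    obtain ⟨r, hr1, hr2⟩ := hev.exists
    have h3 := le_inverseRate ((cumulativeRate_le_add hn hr2.1.le hr2.2).trans_lt hr1)
    exact absurd (h3.trans h) (not_le.2 (ENNReal.coe_lt_coe.2 hr2.1))
  · intro h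
    refine iSup₂_le fun r hr => ENNReal.coe_le_coe.2 (le_of_lt ?_)
    by_contra! hle
    exact absurd (h.trans (cumulativeRate_mono q ω hle)) (not_le.2 hr)

theorem cumulativeRate_of_inverseRate_eq (hs : (s : ℝ≥0∞) < explosionTime q ω) {v : ℝ}
    (h : inverseRate q v ω = s) : cumulativeRate q s ω = ENNReal.ofReal v := by
  refine le_antisymm ?_ ((inverseRate_le_iff hs).1 h.le)
  rcases eq_or_ne s 0 with rfl | h0
  · rw [cumulativeRate_zero]; exact zero_le
  obtain ⟨n, t', ht, hn⟩ := exists_bound_of_lt_explosionTime hs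
  have hcont : Tendsto (fun r : ℝ≥0 => ENNReal.ofReal v + n * ENNReal.ofReal ((s : ℝ) - r))
      (𝓝[<] s) (𝓝 (ENNReal.ofReal v)) := by
    have h1 : Tendsto (fun r : ℝ≥0 => ENNReal.ofReal ((s : ℝ) - r)) (𝓝 s) (𝓝 0) := by
      have : Continuous fun r : ℝ≥0 => ENNReal.ofReal ((s : ℝ) - r) :=
        ENNReal.continuous_ofReal.comp (by fun_prop)
      simpa using this.tendsto s
    have h2 := (ENNReal.Tendsto.const_mul (a := (n : ℝ≥0∞)) h1
      (Or.inr (ENNReal.natCast_ne_top n))).const_add (ENNReal.ofReal v)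
    rw [mul_zero, add_zero] at h2
    exact h2.mono_left nhdsWithin_le_nhds
  have : (𝓝[<] s).NeBot := nhdsLT_neBot_of_exists_lt ⟨0, pos_iff_ne_zero.2 h0⟩
  refine ge_of_tendsto hcont ?_
  filter_upwards [self_mem_nhdsWithin] with r hr
  refine (cumulativeRate_le_add hn (le_of_lt hr) ht).trans ?_
  gcongr
  refine (cumulativeRate_lt_of_lt_inverseRate ?_).le
  rw [h]
  exact ENNReal.coe_lt_coe.2 hr

theorem inverseRate_lt_inverseRate {v v' : ℝ} (hv : inverseRate q v ω < explosionTime q ω)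
    (hv' : 0 < v') (h : v < v') : inverseRate q v ω < inverseRate q v' ω := by
  lift inverseRate q v ω to ℝ≥0 using (hv.trans_le le_top).ne with s hs
  by_contra! hle
  rw [inverseRate_le_iff hv, cumulativeRate_of_inverseRate_eq hv hs.symm] at hle
  exact absurd hle (not_le.2 ((ENNReal.ofReal_lt_ofReal_iff hv').2 h))

/-- The generalized inverse of the cumulative rate is left-continuous. -/
theorem inverseRate_eq_iSup (v : ℝ) :
    inverseRate q v ω = ⨆ (p : ℚ) (_ : (p : ℝ) < v), inverseRate q p ω := by
  refine le_antisymm (iSup₂_le fun r hr => ?_) (iSup₂_le fun p hp => inverseRate_mono hp.le)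
  have hv : 0 < v := by
    by_contra! h
    simp [ENNReal.ofReal_of_nonpos h] at hr
  have hr' : (cumulativeRate q r ω).toReal < v := by
    have := (ENNReal.toReal_lt_toReal (hr.trans_le le_top).ne ENNReal.ofReal_ne_top).2 hr
    rwa [ENNReal.toReal_ofReal hv.le] at this
  obtain ⟨p, hp1, hp2⟩ := exists_rat_btwn hr'
  refine le_trans (le_inverseRate ?_)
    (le_iSup₂ (f := fun (p : ℚ) (_ : (p : ℝ) < v) => inverseRate q p ω) p hp2)
  exact (ENNReal.lt_ofReal_iff_toReal_lt (hr.trans_le le_top).ne).2 hp1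

/-- The substitution `v = ∫_0^s q`. -/
theorem map_inverseRate {t : ℝ≥0}
    (ht : (t : ℝ≥0∞) < explosionTime q ω) :
    (volume.restrict (Ioc 0 (cumulativeRate q t ω).toReal)).map
      (fun v => (inverseRate q v ω).toNNReal) =
    (timeMeasure.restrict (Iic t)).withDensity fun s => (q s ω : ℝ≥0∞) := by
  have htop := cumulativeRate_ne_top ht
  have hm : Measurable fun v => (inverseRate q v ω).toNNReal :=
    inverseRate_mono.measurable.ennreal_toNNReal
  have : IsFiniteMeasure ((volume.restrict (Ioc 0 (cumulativeRate q t ω).toReal)).map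
      (fun v => (inverseRate q v ω).toNNReal)) := Measure.isFiniteMeasure_map _ _
  refine Measure.ext_of_Iic _ _ fun a => ?_
  rw [Measure.map_apply hm measurableSet_Iic, Measure.restrict_apply (hm measurableSet_Iic),
    withDensity_apply _ measurableSet_Iic, Measure.restrict_restrict measurableSet_Iic,
    Iic_inter_Iic]
  have hat : ((a ⊓ t : ℝ≥0) : ℝ≥0∞) < explosionTime q ω :=
    lt_of_le_of_lt (ENNReal.coe_le_coe.2 inf_le_right) ht
  have hset : (fun v => (inverseRate q v ω).toNNReal) ⁻¹' Iic a ∩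
      Ioc 0 (cumulativeRate q t ω).toReal = Ioc 0 (cumulativeRate q (a ⊓ t) ω).toReal := by
    ext v
    simp only [mem_inter_iff, mem_preimage, mem_Iic, mem_Ioc]
    have hle : ∀ s : ℝ≥0, (s : ℝ≥0∞) < explosionTime q ω →
        (v ≤ (cumulativeRate q s ω).toReal ↔ inverseRate q v ω ≤ s) := fun s hs => by
      rw [inverseRate_le_iff hs, ENNReal.ofReal_le_iff_le_toReal (cumulativeRate_ne_top hs)]
    rw [hle t ht, hle _ hat]
    constructor
    · rintro ⟨h1, h2, h3⟩
      refine ⟨h2, ?_⟩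
      lift inverseRate q v ω to ℝ≥0 using (h3.trans_lt ENNReal.coe_lt_top).ne with x
      exact ENNReal.coe_le_coe.2 (le_inf h1 (ENNReal.coe_le_coe.1 h3))
    · rintro ⟨h1, h2⟩
      refine ⟨?_, h1, h2.trans (ENNReal.coe_le_coe.2 inf_le_right)⟩
      exact (ENNReal.toNNReal_mono ENNReal.coe_ne_top h2).trans inf_le_left
  rw [hset, Real.volume_Ioc, sub_zero, ENNReal.ofReal_toReal (cumulativeRate_ne_top hat)]
  rfl

end HybridJump

/-! ### Dependence on the past points -/

namespace HybridJumpProcess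

variable {Ω : Type*} [mΩ : MeasurableSpace Ω] {P : Measure Ω} (X : HybridJumpProcess P)

theorem isMarkedPoisson : IsMarkedPoisson X.w X.u P where
  measurable_w := X.measurable_w
  measurable_u := X.measurable_u
  law_w := X.law_w
  law_u := X.law_u
  indep_w_u := X.indep_w_u
  indep := X.indep

/-- The natural filtration of the jump points of `X`. -/
noncomputable abbrev filtration : Filtration ℝ≥0 mΩ :=
  naturalFiltration X.w X.u X.rate X.measurable_w X.measurable_u X.measurable_rate

/-- The sample space with the σ-algebra of the first `k` points of the driving process. -/
abbrev Past (k : ℕ) : Type _ := PastSpace X.w X.u k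

/-- The position `w_0 + ⋯ + w_{k-1}` of the last of the first `k` points of the driving process. -/
noncomputable def clock (k : ℕ) (ω : Ω) : ℝ := ∑ j ∈ Finset.range k, X.w j ω

theorem clock_succ (k : ℕ) (ω : Ω) : X.clock (k + 1) ω = X.clock k ω + X.w k ω :=
  Finset.sum_range_succ _ _

theorem measurable_clock_past (k : ℕ) : Measurable fun ω : X.Past k => X.clock k ω :=
  Finset.measurable_sum _ fun _ hj => (measurable_past_mark (Finset.mem_range.1 hj)).fst

theorem measurable_lifetime : Measurable X.lifetime := by
  refine measurable_of_Iic fun x => ?_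
  induction x with
  | top => simp
  | coe t => exact X.filtration.le t _ (X.locallyFinite_deriv.isStoppingTime_limit t)

/-- Before the lifetime, the cumulative rate is almost surely adapted. -/
theorem exists_adapted_cumulativeRate [IsProbabilityMeasure P] (s : ℝ≥0) :
    ∃ A : Ω → ℝ≥0∞, Measurable[X.filtration s] A ∧
      ∀ᵐ ω ∂P, (s : ℝ≥0∞) < X.lifetime ω → cumulativeRate X.rate s ω = A ω := by
  classical
  have hbefore : ∀ r : ℝ≥0, MeasurableSet[X.filtration r] {ω | (r : ℝ≥0∞) < X.lifetime ω} := by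
    intro r
    have h := (X.locallyFinite_deriv.isStoppingTime_limit r).compl
    convert h using 1
    ext ω
    simp only [mem_ofPred_eq, mem_compl_iff]
    exact (not_le (α := ℝ≥0∞)).symm
  set F : ℕ → ℝ≥0 → Ω → ℝ := fun n r ω =>
    if (r : ℝ≥0∞) < X.lifetime ω ∧ r ≤ s then (min (X.rate r ω) n : ℝ≥0) else 0 with hF
  have hFm : ∀ n, Measurable (Function.uncurry (F n)) := by
    intro n
    refine Measurable.ite ?_ ?_ measurable_const
    · refine (measurableSet_lt (measurable_fst.coe_nnreal_ennreal)
        (X.measurable_lifetime.comp measurable_snd)).inter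
        (measurable_fst (measurableSet_Iic (a := s)))
    · exact (X.measurable_rate.min measurable_const).coe_nnreal_real
  have hFb : ∀ n r ω, |F n r ω| ≤ n := by
    intro n r ω
    simp only [hF]
    split_ifs
    · rw [NNReal.abs_eq]
      exact_mod_cast min_le_right _ _
    · simp
  have hFa : ∀ n r, Measurable[X.filtration s] (F n r) := by
    intro n r
    by_cases hrs : r ≤ s
    · refine Measurable.mono (ma := X.filtration r) ?_ (X.filtration.mono hrs) le_rfl
      obtain ⟨g, hg, hgr⟩ := Measurable.exists_eq_measurable_comp (mY := X.filtration r)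
        (X.adapted_rate r)
      have : F n r = fun ω => if ω ∈ {ω | (r : ℝ≥0∞) < X.lifetime ω} then
          ((min (g ω) n : ℝ≥0) : ℝ) else 0 := by
        ext ω
        simp only [hF, hrs, and_true, mem_ofPred_eq]
        split_ifs with h
        · rw [show X.rate r ω = g ω from congrFun hgr ⟨ω, h⟩]
        · rfl
      rw [this]
      refine Measurable.ite (hbefore r) ?_ measurable_const
      exact (hg.min measurable_const).coe_nnreal_real
    · have : F n r = fun _ => 0 := by
        ext ω
        simp [hF, hrs]
      rw [this]
      exact measurable_const
  have hex : ∀ n, ∃ g : Ω → ℝ, Measurable[X.filtration s] g ∧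
      (fun ω => ∫ r, F n r ω ∂(timeMeasure.restrict (Iic s))) =ᵐ[P] g := fun n =>
    exists_measurable_integral_ae_eq (m := X.filtration s) (X.filtration.le s)
      (timeMeasure.restrict (Iic s)) (hFm n) (hFb n) (hFa n)
  choose g hg hgF using hex
  refine ⟨fun ω => ⨆ n, ENNReal.ofReal (g n ω),
    Measurable.iSup fun n => (hg n).ennreal_ofReal, ?_⟩
  filter_upwards [ae_all_iff.2 hgF] with ω hω hs
  have hint : ∀ n, ENNReal.ofReal (g n ω) =
      ∫⁻ r in Iic s, ((min (X.rate r ω) n : ℝ≥0) : ℝ≥0∞) ∂timeMeasure := by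
    intro n
    have hmeas : Measurable fun r => F n r ω := (hFm n).of_uncurry_right
    rw [← hω n, ofReal_integral_eq_lintegral_ofReal]
    · refine setLIntegral_congr_fun measurableSet_Iic fun r hr => ?_
      have : (r : ℝ≥0∞) < X.lifetime ω := lt_of_le_of_lt (ENNReal.coe_le_coe.2 hr) hs
      simp only [hF, this, mem_Iic.1 hr, and_self, if_true, ENNReal.ofReal_coe_nnreal]
    · exact Integrable.of_bound hmeas.aestronglyMeasurable n
        (Eventually.of_forall fun r => hFb n r ω)
    · refine Eventually.of_forall fun r => ?_
      simp only [hF, Pi.zero_apply]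
      split_ifs
      · exact NNReal.coe_nonneg _
      · exact le_rfl
  simp_rw [hint]
  refine le_antisymm ?_ (iSup_le fun n => lintegral_mono fun r => by simp)
  obtain ⟨n, t', ht, hn⟩ := exists_bound_of_lt_explosionTime hs
  refine le_iSup_of_le n (setLIntegral_mono' measurableSet_Iic fun r hr => ?_)
  rw [min_eq_left (hn r (lt_of_le_of_lt hr ht))]

theorem ae_w_pos : ∀ᵐ ω ∂P, ∀ i, 0 < X.w i ω := by
  refine ae_all_iff.2 fun i => ?_
  have h : ∀ᵐ x ∂(P.map (X.w i)), 0 < x := by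
    rw [(X.law_w i).map_eq, ae_iff]
    have hm : MeasurableSet {x : ℝ | ¬0 < x} :=
      (measurableSet_lt measurable_const measurable_id).compl
    rw [← lintegral_indicator_one hm, lintegral_expMeasure_one]
    refine (lintegral_eq_zero_iff' ?_).2 ?_
    · exact (Measurable.mul (by fun_prop) (measurable_one.indicator hm)).aemeasurable
    · filter_upwards [ae_restrict_mem measurableSet_Ioi] with x hx
      simp [mem_Ioi.1 hx]
  exact ae_of_ae_map (X.measurable_w i).aemeasurable h

theorem ae_clock_unbounded : ∀ᵐ ω ∂P, ∀ v, ∃ k, v < X.clock k ω := by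
  have key : ∀ N : ℕ, ∀ᵐ ω ∂P, ∃ k, (N : ℝ) < X.clock k ω := by
    intro N
    have : IsProbabilityMeasure (expMeasure 1) := isProbabilityMeasure_expMeasure one_pos
    set c : ℝ≥0∞ := expMeasure 1 (Iic (N : ℝ)) with hc
    have hc1 : c < 1 := by
      have h1 : (expMeasure 1).real (Iic (N : ℝ)) < 1 := by
        rw [← cdf_eq_real, cdf_expMeasure_eq one_pos]
        simp only [Nat.cast_nonneg, if_true]
        linarith [Real.exp_pos (-(1 * (N : ℝ)))]
      rw [measureReal_def, ← ENNReal.toReal_one] at h1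
      exact (ENNReal.toReal_lt_toReal (measure_ne_top _ _) ENNReal.one_ne_top).1 h1
    have hle : ∀ n : ℕ, P {ω | ∀ j ∈ Finset.range n, X.w j ω ≤ N} ≤ c ^ n := by
      intro n
      have h := X.indep.measure_inter_preimage_eq_mul (Finset.range n)
        (sets := fun _ => Iic (N : ℝ) ×ˢ univ) (fun _ _ => measurableSet_Iic.prod .univ)
      have hset : (⋂ i ∈ Finset.range n, (fun ω => (X.w i ω, X.u i ω)) ⁻¹' (Iic (N : ℝ) ×ˢ univ)) =
          {ω | ∀ j ∈ Finset.range n, X.w j ω ≤ N} := by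
        ext ω; simp
      rw [hset] at h
      rw [h]
      have hw : ∀ i, P ((fun ω => (X.w i ω, X.u i ω)) ⁻¹' (Iic (N : ℝ) ×ˢ univ)) = c := by
        intro i
        rw [hc, ← (X.law_w i).map_eq, Measure.map_apply (X.measurable_w i) measurableSet_Iic]
        congr 1
        ext ω; simp
      simp [hw]
    refine measure_mono_null (t := {ω | (∃ i, ¬ 0 < X.w i ω) ∨ ∀ j, X.w j ω ≤ N}) ?_ ?_
    · intro ω hω
      by_contra hcon
      simp only [mem_ofPred_eq, not_or, not_exists, not_not, not_forall, not_le] at hcon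
      obtain ⟨h1, j, hj⟩ := hcon
      refine hω ⟨j + 1, ?_⟩
      rw [clock_succ]
      have : 0 ≤ X.clock j ω := Finset.sum_nonneg fun i _ => (h1 i).le
      linarith
    · refine measure_union_null (s := {ω | ∃ i, ¬ 0 < X.w i ω})
        (t := {ω | ∀ j, X.w j ω ≤ N}) ?_ ?_
      · simpa using ae_iff.1 X.ae_w_pos
      · refine le_antisymm (ge_of_tendsto' (ENNReal.tendsto_pow_atTop_nhds_zero_of_lt_one hc1)
          fun n => (measure_mono ?_).trans (hle n)) zero_le
        exact fun ω hω j _ => hω j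
  filter_upwards [ae_all_iff.2 key] with ω hω v
  obtain ⟨N, hN⟩ := exists_nat_gt v
  obtain ⟨k, hk⟩ := hω N
  exact ⟨k, hN.trans hk⟩

variable [IsProbabilityMeasure P]

/-- The outcomes to which the analysis of the paths applies: the points of the driving process are
positive, increasing and unbounded, and the cumulative rate agrees at rational times with a fixed
adapted version. -/
structure IsRegular (ω : Ω) : Prop where
  w_pos : ∀ i, 0 < X.w i ω
  clock_unbounded : ∀ v, ∃ k, v < X.clock k ω
  rate_eq : ∀ p : ℚ, ((Real.toNNReal p : ℝ≥0) : ℝ≥0∞) < X.lifetime ω →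
    cumulativeRate X.rate (Real.toNNReal p) ω =
      (X.exists_adapted_cumulativeRate (Real.toNNReal p)).choose ω

theorem ae_isRegular : ∀ᵐ ω ∂P, X.IsRegular ω := by
  have h : ∀ᵐ ω ∂P, ∀ p : ℚ, ((Real.toNNReal p : ℝ≥0) : ℝ≥0∞) < X.lifetime ω →
      cumulativeRate X.rate (Real.toNNReal p) ω =
        (X.exists_adapted_cumulativeRate (Real.toNNReal p)).choose ω :=
    ae_all_iff.2 fun p => (X.exists_adapted_cumulativeRate (Real.toNNReal p)).choose_spec.2
  filter_upwards [X.ae_w_pos, X.ae_clock_unbounded, h] with ω h1 h2 h3 using ⟨h1, h2, h3⟩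

variable {X}

theorem IsRegular.clock_strictMono {ω : Ω} (h : X.IsRegular ω) : StrictMono fun k => X.clock k ω :=
  strictMono_nat_of_lt_succ fun k => by
    simp only [clock_succ]
    linarith [h.w_pos k]

theorem IsRegular.clock_succ_pos {ω : Ω} (h : X.IsRegular ω) (k : ℕ) : 0 < X.clock (k + 1) ω := by
  have := h.clock_strictMono k.succ_pos
  simpa [clock] using this

variable (X)

/-- The regular outcomes for which the `k`-th point of the driving process is reached during the
lifetime, and for which the time `s` precedes both the jump at the next point and the end of the
lifetime: for these, all jumps up to the time `s` come from the first `k` points. -/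
def beforeJump (k : ℕ) (s : ℝ≥0) : Set Ω :=
  {ω | X.IsRegular ω ∧ inverseRate X.rate (X.clock k ω) ω < X.lifetime ω ∧
    (s : ℝ≥0∞) < inverseRate X.rate (X.clock (k + 1) ω) ω ∧ (s : ℝ≥0∞) < X.lifetime ω}

/-- If it precedes the end of the lifetime, the time of jump `j` (counted from zero) is a function of
the first `j + 1` points of the driving process. -/
def JumpTimeFromPast (j : ℕ) : Prop :=
  ∃ r : X.Past (j + 1) → ℝ≥0∞, Measurable r ∧ ∀ ω : Ω, X.IsRegular ω →
    inverseRate X.rate (X.clock (j + 1) ω) ω < X.lifetime ω →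
      r ω = inverseRate X.rate (X.clock (j + 1) ω) ω

variable {X}

/-- Before the next jump, an event in the natural filtration depends on the past points only. -/
theorem exists_past_event {k : ℕ} (hk : ∀ j < k, X.JumpTimeFromPast j) (s : ℝ≥0) {E : Set Ω}
    (hE : MeasurableSet[X.filtration s] E) :
    ∃ E' : Set (X.Past k), MeasurableSet E' ∧
      ∀ ω ∈ X.beforeJump k s, (ω ∈ E ↔ toPast X.w X.u k ω ∈ E') := by
  refine MeasurableSpace.generateFrom_induction _
    (fun E _ => ∃ E' : Set (X.Past k), MeasurableSet E' ∧
      ∀ ω ∈ X.beforeJump k s, (ω ∈ E ↔ toPast X.w X.u k ω ∈ E')) ?_ ?_ ?_ ?_ E hE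
  · rintro _ ⟨B, hB, hBs, rfl⟩ _
    have he : MeasurableEmbedding (fun p : ℝ≥0 × unitInterval => ((p.1 : ℝ≥0∞), p.2)) :=
      (ENNReal.isOpenEmbedding_coe.measurableEmbedding).prodMap MeasurableEmbedding.id
    choose! r hrm hr using hk
    refine ⟨⋃ j : ℕ, ⋃ _ : j < k, {ω : X.Past k | (r j ω, X.u j ω) ∈
        (fun p : ℝ≥0 × unitInterval => ((p.1 : ℝ≥0∞), p.2)) '' B}, ?_, ?_⟩
    · refine MeasurableSet.iUnion fun j => MeasurableSet.iUnion fun hj => ?_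
      exact (((hrm j hj).comp (measurable_past_shift hj)).prodMk
        (measurable_past_mark hj).snd) (he.measurableSet_image' hB)
    · rintro ω ⟨hreg, hlife, hnext, -⟩
      have hrj : ∀ j < k, r j ω = inverseRate X.rate (X.clock (j + 1) ω) ω := fun j hj =>
        hr j hj ω hreg (lt_of_le_of_lt (inverseRate_mono (hreg.clock_strictMono.monotone hj)) hlife)
      simp only [mem_iUnion]
      constructor
      · rintro ⟨p, ⟨i, h1, h2⟩, hp⟩
        have hik : i < k := by
          by_contra! hle
          have h3 : inverseRate X.rate (X.clock (k + 1) ω) ω ≤ p.1 := by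
            rw [← h1]
            exact inverseRate_mono (hreg.clock_strictMono.monotone (Nat.succ_le_succ hle))
          have h4 : p.1 ≤ s := (hBs hp).1
          exact absurd (hnext.trans_le h3) (not_lt.2 (ENNReal.coe_le_coe.2 h4))
        refine ⟨i, hik, p, hp, ?_⟩
        simp only [Prod.mk.injEq]
        exact ⟨by rw [toPast, hrj i hik, ← h1]; rfl, h2.symm⟩
      · rintro ⟨j, hj, p, hp, h⟩
        simp only [Prod.mk.injEq] at h
        refine ⟨p, ⟨j, ?_, h.2.symm⟩, hp⟩
        rw [h.1, toPast, hrj j hj]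
        rfl
  · exact ⟨∅, MeasurableSet.empty, fun ω _ => by simp⟩
  · rintro E - ⟨E', hE', h⟩
    exact ⟨E'ᶜ, hE'.compl, fun ω hω => not_congr (h ω hω)⟩
  · intro E _ h
    choose E' hE' h using h
    refine ⟨⋃ n, E' n, MeasurableSet.iUnion hE', fun ω hω => ?_⟩
    simp only [mem_iUnion]
    exact exists_congr fun n => h n ω hω

theorem exists_past_function {k : ℕ} (hk : ∀ j < k, X.JumpTimeFromPast j) (s : ℝ≥0) {β : Type*}
    [MeasurableSpace β] [StandardBorelSpace β] [Nonempty β] {g : Ω → β}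
    (hg : Measurable[X.filtration s] g) :
    ∃ g' : X.Past k → β, Measurable g' ∧ ∀ ω ∈ X.beforeJump k s, g' ω = g ω := by
  let i : X.beforeJump k s → X.Past k := fun ω => toPast X.w X.u k ω
  have h : Measurable[MeasurableSpace.comap i inferInstance] fun ω : X.beforeJump k s => g ω := by
    intro S hS
    obtain ⟨E', hE', h⟩ := exists_past_event hk s (hg hS)
    refine ⟨E', hE', ?_⟩
    ext ω
    exact (h ω ω.2).symm
  obtain ⟨g', hg', hgg⟩ := h.exists_eq_measurable_comp
  exact ⟨g', hg', fun ω hω => (congrFun hgg ⟨ω, hω⟩).symm⟩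

/-- Up to the next jump, the inverse of the cumulative rate depends on the past points only. -/
theorem exists_past_inverseRate {k : ℕ} (hk : ∀ j < k, X.JumpTimeFromPast j) :
    ∃ ρ : X.Past k → ℝ → ℝ≥0∞, Measurable (fun p : X.Past k × ℝ => ρ p.1 p.2) ∧
      ∀ ω : Ω, X.IsRegular ω → inverseRate X.rate (X.clock k ω) ω < X.lifetime ω →
        ∀ v ≤ X.clock (k + 1) ω, inverseRate X.rate v ω < X.lifetime ω →
          ρ ω v = inverseRate X.rate v ω := by
  classical
  choose Φ hΦm hΦ using fun p : ℚ => exists_past_function hk (Real.toNNReal p)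
    (X.exists_adapted_cumulativeRate (Real.toNNReal p)).choose_spec.1
  set σ : X.Past k → ℝ → ℝ≥0∞ := fun ω v =>
    ⨅ p : ℚ, if ENNReal.ofReal v ≤ Φ p ω then ((Real.toNNReal p : ℝ≥0) : ℝ≥0∞) else ∞ with hσ
  have hσm : ∀ v, Measurable fun ω => σ ω v := fun v =>
    Measurable.iInf fun p => Measurable.ite (measurableSet_le measurable_const (hΦm p))
      measurable_const measurable_const
  refine ⟨fun ω v => ⨆ p : ℚ, if (p : ℝ) < v then σ ω p else 0, ?_, ?_⟩
  · refine Measurable.iSup fun p => Measurable.ite ?_ ((hσm p).comp measurable_fst) measurable_const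
    exact measurableSet_lt measurable_const measurable_snd
  intro ω hreg hlife v hv hvlife
  have hΦ' : ∀ p : ℚ, ((Real.toNNReal p : ℝ≥0) : ℝ≥0∞) < X.lifetime ω →
      ((Real.toNNReal p : ℝ≥0) : ℝ≥0∞) < inverseRate X.rate (X.clock (k + 1) ω) ω →
      Φ p ω = cumulativeRate X.rate (Real.toNNReal p) ω := fun p h1 h2 => by
    rw [hΦ p ω ⟨hreg, hlife, h2, h1⟩, hreg.rate_eq p h1]
  have key : ∀ v' < X.clock (k + 1) ω, inverseRate X.rate v' ω < X.lifetime ω →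
      σ ω v' = inverseRate X.rate v' ω := by
    intro v' hv' hlife'
    have hlt := inverseRate_lt_inverseRate hlife' (hreg.clock_succ_pos k) hv'
    refine le_antisymm (le_of_not_gt fun hcon => ?_) (le_iInf fun p => ?_)
    · obtain ⟨p, -, hp1, hp2⟩ := ENNReal.lt_iff_exists_rat_btwn.1 (lt_min hcon (lt_min hlt hlife'))
      obtain ⟨hp2, hp3, hp4⟩ := by simpa only [lt_min_iff] using hp2
      have h1 : ENNReal.ofReal v' ≤ Φ p ω := by
        rw [hΦ' p hp4 hp3]
        exact (inverseRate_le_iff hp4).1 hp1.le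
      refine absurd hp2 (not_lt.2 (iInf_le_of_le p ?_))
      rw [if_pos h1]
    · split_ifs with h
      · refine le_of_not_gt fun hcon => absurd h (not_le.2 ?_)
        rw [hΦ' p (hcon.trans hlife') (hcon.trans hlt)]
        exact cumulativeRate_lt_of_lt_inverseRate hcon
      · exact le_top
  rw [inverseRate_eq_iSup v]
  refine iSup_congr fun p => ?_
  by_cases hp : (p : ℝ) < v
  · simp only [hp, if_true, iSup_true]
    exact key p (hp.trans_le hv) (lt_of_le_of_lt (inverseRate_mono hp.le) hvlife)
  · simp [hp]

theorem jumpTimeFromPast (j : ℕ) : X.JumpTimeFromPast j := by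
  induction j using Nat.strong_induction_on with
  | _ j ih =>
    obtain ⟨ρ, hρm, hρ⟩ := exists_past_inverseRate ih
    refine ⟨fun ω => ρ ω (X.clock (j + 1) ω), ?_, fun ω hreg hlife => ?_⟩
    · exact hρm.comp ((measurable_past_shift j.le_succ).prodMk (X.measurable_clock_past (j + 1)))
    · refine hρ ω hreg (lt_of_le_of_lt (inverseRate_mono ?_) hlife) _ le_rfl hlife
      exact hreg.clock_strictMono.monotone j.le_succ

/-- Up to the next jump, the jump function depends on the past points only: this is where the
predictability of the jump function enters. -/
theorem exists_past_jump (k : ℕ) :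
    ∃ J : X.Past k → ℝ≥0 → unitInterval → ℝ,
      Measurable (fun p : X.Past k × ℝ≥0 × unitInterval => J p.1 p.2.1 p.2.2) ∧
      ∀ ω : Ω, X.IsRegular ω → ∀ s : ℝ≥0, inverseRate X.rate (X.clock k ω) ω < s →
        (s : ℝ≥0∞) ≤ inverseRate X.rate (X.clock (k + 1) ω) ω → (s : ℝ≥0∞) < X.lifetime ω →
          ∀ v, J ω s v = X.jump s ω v := by
  set T : Set (ℝ≥0 × Ω) := {p | X.IsRegular p.2 ∧
    inverseRate X.rate (X.clock k p.2) p.2 < p.1 ∧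
    (p.1 : ℝ≥0∞) ≤ inverseRate X.rate (X.clock (k + 1) p.2) p.2 ∧
    (p.1 : ℝ≥0∞) < X.lifetime p.2} with hT
  have hpred : ∀ E, MeasurableSet[X.filtration.predictable] E →
      ∃ E' : Set (ℝ≥0 × X.Past k), MeasurableSet E' ∧
        ∀ p ∈ T, (p ∈ E ↔ (p.1, toPast X.w X.u k p.2) ∈ E') := by
    intro E hE
    refine MeasurableSpace.generateFrom_induction _
      (fun E _ => ∃ E' : Set (ℝ≥0 × X.Past k), MeasurableSet E' ∧
        ∀ p ∈ T, (p ∈ E ↔ (p.1, toPast X.w X.u k p.2) ∈ E')) ?_ ?_ ?_ ?_ E hE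
    · rintro _ (⟨A, hA, rfl⟩ | ⟨s, A, hA, rfl⟩) _
      · refine ⟨∅, MeasurableSet.empty, ?_⟩
        rintro ⟨s, ω⟩ ⟨-, h, -⟩
        simp only [mem_prod, mem_singleton_iff, mem_empty_iff_false, iff_false, not_and]
        rintro rfl
        exact absurd h (by simp)
      · obtain ⟨A', hA', h⟩ := exists_past_event (k := k) (fun j _ => jumpTimeFromPast j) s hA
        refine ⟨Ioi s ×ˢ A', measurableSet_Ioi.prod hA', ?_⟩
        rintro ⟨t, ω⟩ ⟨h1, h2, h3, h4⟩
        simp only [mem_prod, mem_Ioi]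
        refine and_congr_right fun hst => h ω ⟨h1, h2.trans h4, ?_, ?_⟩
        · exact lt_of_lt_of_le (ENNReal.coe_lt_coe.2 hst) h3
        · exact lt_trans (ENNReal.coe_lt_coe.2 hst) h4
    · exact ⟨∅, MeasurableSet.empty, fun ω _ => by simp⟩
    · rintro E - ⟨E', hE', h⟩
      exact ⟨E'ᶜ, hE'.compl, fun ω hω => not_congr (h ω hω)⟩
    · intro E _ h
      choose E' hE' h using h
      refine ⟨⋃ n, E' n, MeasurableSet.iUnion hE', fun ω hω => ?_⟩
      simp only [mem_iUnion]
      exact exists_congr fun n => h n ω hω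
  let i : T × unitInterval → X.Past k × ℝ≥0 × unitInterval :=
    fun p => (toPast X.w X.u k p.1.1.2, p.1.1.1, p.2)
  let mT : MeasurableSpace (T × unitInterval) := MeasurableSpace.comap i inferInstance
  have hi : Measurable[mT] i := comap_measurable i
  have hfst : @Measurable _ _ mT X.filtration.predictable fun p : T × unitInterval => p.1.1 := by
    intro E hE
    obtain ⟨E', hE', h⟩ := hpred E hE
    refine ⟨(fun q : X.Past k × ℝ≥0 × unitInterval => (q.2.1, q.1)) ⁻¹' E',
      (by fun_prop : Measurable fun q : X.Past k × ℝ≥0 × unitInterval => (q.2.1, q.1)) hE', ?_⟩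
    ext p
    exact (h p.1.1 p.1.2).symm
  have hpair : @Measurable _ _ mT
      (MeasurableSpace.prod X.filtration.predictable inferInstance)
      fun p : T × unitInterval => ((p.1.1, p.2) : (ℝ≥0 × Ω) × unitInterval) :=
    hfst.prodMk hi.snd.snd
  have hjump : Measurable[mT] fun p : T × unitInterval => X.jump p.1.1.1 p.1.1.2 p.2 := by
    intro S hS
    obtain ⟨D, hD, hDS⟩ := X.predictable_jump hS
    have : (fun p : T × unitInterval => X.jump p.1.1.1 p.1.1.2 p.2) ⁻¹' S =
        (fun p : T × unitInterval => ((p.1.1, p.2) : (ℝ≥0 × Ω) × unitInterval)) ⁻¹' D := by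
      ext p
      exact (Set.ext_iff.1 hDS ⟨(p.1.1, p.2), p.1.2.2.2.2⟩).symm
    rw [this]
    exact hpair hD
  obtain ⟨J, hJ, hJX⟩ := hjump.exists_eq_measurable_comp
  refine ⟨fun ω s v => J (ω, s, v), hJ, fun ω h1 s h2 h3 h4 v => ?_⟩
  exact (congrFun hJX (⟨(s, ω), h1, h2, h3, h4⟩, v)).symm

/-- In the time scale of the driving process, the jump function between two of its points depends
on the past points only. -/
theorem exists_past_jump_clock (k : ℕ) :
    ∃ J : X.Past k → ℝ → unitInterval → ℝ,
      Measurable (fun p : X.Past k × ℝ × unitInterval => J p.1 p.2.1 p.2.2) ∧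
      ∀ ω : Ω, X.IsRegular ω → ∀ y, 0 < y → y ≤ X.w k ω → ∀ s : ℝ≥0,
        inverseRate X.rate (X.clock k ω + y) ω = s → (s : ℝ≥0∞) < X.lifetime ω →
          ∀ v, J ω y v = X.jump s ω v := by
  obtain ⟨ρ, hρm, hρ⟩ := exists_past_inverseRate (X := X) (k := k) fun j _ => jumpTimeFromPast j
  obtain ⟨J, hJm, hJ⟩ := exists_past_jump (X := X) k
  refine ⟨fun ω y v => J ω (ρ ω (X.clock k ω + y)).toNNReal v, ?_, ?_⟩
  · have h1 : Measurable fun p : X.Past k × ℝ × unitInterval => ρ p.1 (X.clock k p.1 + p.2.1) :=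
      hρm.comp (measurable_fst.prodMk
        (((X.measurable_clock_past k).comp measurable_fst).add measurable_snd.fst))
    exact hJm.comp (measurable_fst.prodMk (h1.ennreal_toNNReal.prodMk measurable_snd.snd))
  · intro ω hreg y hy hyw s hs hlife v
    have hclock : 0 ≤ X.clock k ω := Finset.sum_nonneg fun i _ => (hreg.w_pos i).le
    have hle : X.clock k ω + y ≤ X.clock (k + 1) ω := by
      rw [clock_succ]; linarith
    have hk : inverseRate X.rate (X.clock k ω) ω < X.lifetime ω :=
      lt_of_le_of_lt (inverseRate_mono (by linarith)) (hs.trans_lt hlife)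
    have hρs : ρ ω (X.clock k ω + y) = s := by
      rw [hρ ω hreg hk _ hle (hs.trans_lt hlife), hs]
    simp only [hρs, ENNReal.toNNReal_coe]
    refine hJ ω hreg s ?_ ?_ hlife v
    · rw [← hs]
      exact inverseRate_lt_inverseRate hk (by linarith) (by linarith)
    · rw [← hs]
      exact inverseRate_mono hle

end HybridJumpProcess

/-! ### Exponential compensator, drift and quadratic variation -/

theorem expNeg_add (x y : ℝ≥0∞) : expNeg (x + y) = expNeg x * expNeg y := by
  rcases eq_or_ne x ∞ with rfl | hx
  · simp
  rcases eq_or_ne y ∞ with rfl | hy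
  · simp
  rw [← ENNReal.ofReal_toReal hx, ← ENNReal.ofReal_toReal hy,
    ← ENNReal.ofReal_add ENNReal.toReal_nonneg ENNReal.toReal_nonneg,
    expNeg_ofReal ENNReal.toReal_nonneg, expNeg_ofReal ENNReal.toReal_nonneg,
    expNeg_ofReal (add_nonneg ENNReal.toReal_nonneg ENNReal.toReal_nonneg),
    ← ENNReal.ofReal_mul (Real.exp_pos _).le, ← Real.exp_add, neg_add]

/-- The second-order remainder of the exponential function: `e^x - 1 - x ≤ x²/2 e^{|x|}`. -/
theorem exp_le_one_add_add_sq_mul {x b : ℝ} (hx : |x| ≤ b) :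
    Real.exp x ≤ 1 + x + x ^ 2 / 2 * Real.exp b := by
  have key : ∀ y : ℝ, 0 ≤ y → Real.exp y ≤ 1 + y + y ^ 2 / 2 * Real.exp y := by
    intro y hy
    -- Multiplied by `e^{-y}`, the claim reads `1 ≤ y²/2 + (1 + y) e^{-y}`.
    have hmono : MonotoneOn (fun y : ℝ => y ^ 2 / 2 + (1 + y) * Real.exp (-y)) (Ici 0) := by
      refine monotoneOn_of_deriv_nonneg (convex_Ici 0) (by fun_prop) (by fun_prop) fun z hz => ?_
      rw [interior_Ici, mem_Ioi] at hz
      have hd : HasDerivAt (fun y : ℝ => y ^ 2 / 2 + (1 + y) * Real.exp (-y))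
          (z * (1 - Real.exp (-z))) z := by
        have h1 : HasDerivAt (fun y : ℝ => y ^ 2 / 2) z z := by
          simpa using (hasDerivAt_pow 2 z).div_const 2
        have h2 : HasDerivAt (fun y : ℝ => Real.exp (-y)) (Real.exp (-z) * -1) z :=
          (hasDerivAt_neg z).exp
        have h3 : HasDerivAt (fun y : ℝ => 1 + y) 1 z := (hasDerivAt_id z).const_add 1
        exact (h1.add (h3.mul h2)).congr_deriv (by ring)
      rw [hd.deriv]
      have : Real.exp (-z) ≤ 1 := Real.exp_le_one_iff.2 (by linarith)
      exact mul_nonneg hz.le (by linarith)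
    have h := hmono (mem_Ici.2 le_rfl) (mem_Ici.2 hy) hy
    simp only [neg_zero, Real.exp_zero] at h
    have h' := mul_le_mul_of_nonneg_right h (Real.exp_pos y).le
    have he : Real.exp (-y) * Real.exp y = 1 := by rw [← Real.exp_add]; simp
    nlinarith
  have hb : 0 ≤ b := (abs_nonneg x).trans hx
  rcases le_total 0 x with h | h
  · rw [abs_of_nonneg h] at hx
    refine (key x h).trans ?_
    gcongr
  · have h1 : Real.exp x ≤ 1 + x + x ^ 2 / 2 := by
      have hanti : AntitoneOn (fun y : ℝ => 1 + y + y ^ 2 / 2 - Real.exp y) (Iic 0) := by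
        refine antitoneOn_of_deriv_nonpos (convex_Iic 0) (by fun_prop) (by fun_prop) fun z _ => ?_
        have hd : HasDerivAt (fun y : ℝ => 1 + y + y ^ 2 / 2 - Real.exp y)
            (1 + z - Real.exp z) z := by
          have h1 : HasDerivAt (fun y : ℝ => y ^ 2 / 2) z z := by
            simpa using (hasDerivAt_pow 2 z).div_const 2
          exact (((hasDerivAt_id z).const_add 1).add h1).sub (Real.hasDerivAt_exp z)
        rw [hd.deriv]
        linarith [Real.add_one_le_exp z]
      have := hanti (mem_Iic.2 h) (mem_Iic.2 le_rfl) h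
      simp only [Real.exp_zero] at this
      linarith
    have h2 : x ^ 2 / 2 * 1 ≤ x ^ 2 / 2 * Real.exp b := by
      gcongr
      exact Real.one_le_exp hb
    linarith

/-- The exponential compensator of a bounded jump function is dominated by its drift and its
quadratic variation. -/
theorem integral_exp_le_of_bounded {T : Type*} [MeasurableSpace T] {μ : Measure T}
    [IsFiniteMeasure μ] {q : T → ℝ≥0} (hq : Measurable q) {n : ℝ≥0} (hqn : ∀ᵐ s ∂μ, q s ≤ n)
    {h : T → unitInterval → ℝ} (hh : Measurable (Function.uncurry h)) {c : ℝ}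
    (hc : ∀ᵐ s ∂μ, ∀ᵐ v, |h s v| ≤ c) (θ : ℝ) :
    Integrable (fun s => (q s : ℝ) * ∫ v, h s v) μ ∧
    Integrable (fun s => (q s : ℝ) * ∫ v, Real.exp (θ * h s v)) μ ∧
    ∫ s, ((q s : ℝ) * ∫ v, Real.exp (θ * h s v)) ∂μ ≤ (∫ s, (q s : ℝ) ∂μ) +
      θ * (∫ s, ((q s : ℝ) * ∫ v, h s v) ∂μ) +
      θ ^ 2 / 2 * Real.exp (|θ| * c) * ∫ s, ((q s : ℝ) * ∫ v, h s v ^ 2) ∂μ := by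
  have hqm : Measurable fun s => (q s : ℝ) := hq.coe_nnreal_real
  have hqb : ∀ᵐ s ∂μ, ‖(q s : ℝ)‖ ≤ n := by
    filter_upwards [hqn] with s hs
    rw [Real.norm_of_nonneg (q s).coe_nonneg]
    exact_mod_cast hs
  have hsec : ∀ s, Measurable (h s) := fun s => hh.comp measurable_prodMk_left
  -- Each of the three inner integrals is bounded and measurable.
  have hint : ∀ (φ : ℝ → ℝ) (_ : Continuous φ) (b : ℝ), (∀ x, |x| ≤ c → |φ x| ≤ b) →
      (∀ᵐ s ∂μ, Integrable (fun v => φ (h s v))) ∧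
      Integrable (fun s => (q s : ℝ) * ∫ v, φ (h s v)) μ := by
    intro φ hφ b hb
    refine ⟨?_, ?_⟩
    · filter_upwards [hc] with s hs
      refine Integrable.of_bound (hφ.measurable.comp (hsec s)).aestronglyMeasurable b ?_
      filter_upwards [hs] with v hv using hb _ hv
    · have hm : Measurable fun s => ∫ v, φ (h s v) :=
        (StronglyMeasurable.integral_prod_right (f := fun s v => φ (h s v))
          (hφ.measurable.comp hh).stronglyMeasurable).measurable
      refine Integrable.of_bound (hqm.mul hm).aestronglyMeasurable (n * b) ?_
      filter_upwards [hqb, hc] with s hs hs'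
      rw [norm_mul]
      refine mul_le_mul hs ?_ (norm_nonneg _) n.coe_nonneg
      have := norm_integral_le_of_norm_le_const (μ := (volume : Measure unitInterval))
        (f := fun v => φ (h s v)) (C := b) (by filter_upwards [hs'] with v hv using hb _ hv)
      simpa using this
  have hexpb : ∀ x, |x| ≤ c → |Real.exp (θ * x)| ≤ Real.exp (|θ| * c) := by
    intro x hx
    rw [abs_of_pos (Real.exp_pos _), Real.exp_le_exp]
    refine (le_abs_self _).trans ?_
    rw [abs_mul]
    gcongr
  obtain ⟨h1, h1'⟩ := hint (fun x => x) continuous_id c fun x hx => hx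
  obtain ⟨h2, h2'⟩ := hint (fun x => Real.exp (θ * x)) (by fun_prop) _ hexpb
  obtain ⟨h3, h3'⟩ := hint (fun x => x ^ 2) (by fun_prop) (c ^ 2) fun x hx => by
    rw [abs_pow]; gcongr
  have hqi : Integrable (fun s => (q s : ℝ)) μ :=
    Integrable.of_bound hqm.aestronglyMeasurable n hqb
  refine ⟨h1', h2', ?_⟩
  calc ∫ s, ((q s : ℝ) * ∫ v, Real.exp (θ * h s v)) ∂μ
      ≤ ∫ s, ((q s : ℝ) + θ * ((q s : ℝ) * ∫ v, h s v)) +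
          θ ^ 2 / 2 * Real.exp (|θ| * c) * ((q s : ℝ) * ∫ v, h s v ^ 2) ∂μ := by
        refine integral_mono_ae h2' ((hqi.add (h1'.const_mul θ)).add (h3'.const_mul _)) ?_
        filter_upwards [hc, h1, h2, h3] with s hs i1 i2 i3
        have hle : ∫ v, Real.exp (θ * h s v) ≤
            1 + θ * (∫ v, h s v) + θ ^ 2 / 2 * Real.exp (|θ| * c) * ∫ v, h s v ^ 2 := by
          calc ∫ v, Real.exp (θ * h s v)
              ≤ ∫ v, ((1 + θ * h s v) + θ ^ 2 / 2 * Real.exp (|θ| * c) * h s v ^ 2) := by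
                refine integral_mono_ae i2
                  (((integrable_const 1).add (i1.const_mul θ)).add (i3.const_mul _)) ?_
                filter_upwards [hs] with v hv
                have := exp_le_one_add_add_sq_mul (x := θ * h s v) (b := |θ| * c) (by
                  rw [abs_mul]; gcongr)
                refine this.trans (le_of_eq ?_)
                ring
            _ = _ := by
                rw [integral_add (by exact (integrable_const 1).add (i1.const_mul θ))
                  (by exact i3.const_mul _), integral_add (integrable_const 1)
                  (by exact i1.const_mul θ), integral_const_mul, integral_const_mul]
                simp
        calc (q s : ℝ) * ∫ v, Real.exp (θ * h s v)
            ≤ (q s : ℝ) * (1 + θ * (∫ v, h s v) +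
              θ ^ 2 / 2 * Real.exp (|θ| * c) * ∫ v, h s v ^ 2) :=
              mul_le_mul_of_nonneg_left hle (q s).coe_nonneg
          _ = _ := by ring
    _ = _ := by
        rw [integral_add (by exact hqi.add (h1'.const_mul θ)) (by exact h3'.const_mul _),
          integral_add hqi (by exact h1'.const_mul θ), integral_const_mul, integral_const_mul]

namespace HybridJumpProcess

variable {Ω : Type*} [mΩ : MeasurableSpace Ω] {P : Measure Ω} (X : HybridJumpProcess P)

theorem predictable_le :
    X.filtration.predictable ≤ (inferInstance : MeasurableSpace (ℝ≥0 × Ω)) := by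
  refine MeasurableSpace.generateFrom_le ?_
  rintro _ (⟨A, hA, rfl⟩ | ⟨s, A, hA, rfl⟩)
  · exact (measurableSet_singleton _).prod (X.filtration.le _ _ hA)
  · exact measurableSet_Ioi.prod (X.filtration.le _ _ hA)

theorem exists_measurable_jump : ∃ g : ℝ≥0 → Ω → unitInterval → ℝ,
    Measurable (fun p : (ℝ≥0 × Ω) × unitInterval => g p.1.1 p.1.2 p.2) ∧
    ∀ (s : ℝ≥0) (ω : Ω), (s : ℝ≥0∞) < X.lifetime ω → g s ω = X.jump s ω := by
  obtain ⟨g, hg, hgX⟩ := Measurable.exists_eq_measurable_comp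
    (mY := MeasurableSpace.prod X.filtration.predictable inferInstance) X.predictable_jump
  refine ⟨fun s ω v => g ((s, ω), v), hg.mono ?_ le_rfl, fun s ω hs => funext fun v => ?_⟩
  · exact sup_le_sup (MeasurableSpace.comap_mono X.predictable_le) le_rfl
  · exact (congrFun hgX ⟨((s, ω), v), hs⟩).symm

theorem ae_integrableOn_deriv : ∀ᵐ ω ∂P, ∀ t : ℝ≥0, (t : ℝ≥0∞) < X.lifetime ω →
    IntegrableOn (fun s => X.deriv s ω) (Iic t) timeMeasure := by
  obtain ⟨d, hd, hdX⟩ := X.measurable_deriv.exists_eq_measurable_comp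
  filter_upwards [X.locallyFinite_deriv.tendsto] with ω hω t ht
  have hds : ∀ s ∈ Iic t, d (s, ω) = X.deriv s ω := fun s hs =>
    (congrFun hdX ⟨(s, ω), lt_of_le_of_lt (ENNReal.coe_le_coe.2 hs) ht⟩).symm
  refine IntegrableOn.congr_fun (f := fun s => d (s, ω)) ?_ hds measurableSet_Iic
  refine ⟨(hd.comp measurable_prodMk_right).aestronglyMeasurable, ?_⟩
  obtain ⟨n, hn⟩ := (hω.eventually_const_lt ht).exists
  have hfin : ∫⁻ s in Iic t, ‖X.deriv s ω‖ₑ ∂timeMeasure < n := by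
    by_contra! hle
    have h1 := (lt_min_iff.1 hn).2
    exact absurd h1 (not_lt.2 (iInf₂_le t hle))
  rw [hasFiniteIntegral_iff_enorm]
  refine lt_of_le_of_lt (le_of_eq ?_) (hfin.trans (ENNReal.natCast_lt_top n))
  exact setLIntegral_congr_fun measurableSet_Iic fun s hs => by simp only [hds s hs]

theorem ae_jump_bounded [SFinite P] {c : ℝ} (hX : X.JumpBoundedBy c) :
    ∀ᵐ ω ∂P, ∀ᵐ (s : ℝ≥0) ∂timeMeasure, (s : ℝ≥0∞) < X.lifetime ω →
      ∀ᵐ v, |X.jump s ω v| ≤ c := by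
  have h1 : ∀ᵐ p ∂(P.prod (timeMeasure.prod (volume : Measure unitInterval))),
      (p.2.1 : ℝ≥0∞) < X.lifetime p.1 → |X.jump p.2.1 p.1 p.2.2| ≤ c := by
    have e1 : MeasurePreserving (fun p : Ω × ℝ≥0 × unitInterval => (p.2.1, p.2.2, p.1))
        (P.prod (timeMeasure.prod volume))
        (timeMeasure.prod ((volume : Measure unitInterval).prod P)) :=
      (measurePreserving_prodAssoc timeMeasure (volume : Measure unitInterval) P).comp
        Measure.measurePreserving_swap
    exact e1.quasiMeasurePreserving.ae hX
  filter_upwards [Measure.ae_ae_of_ae_prod h1] with ω hω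
  filter_upwards [Measure.ae_ae_of_ae_prod hω] with s hs hlife
  filter_upwards [hs] with v hv using hv hlife

variable [IsProbabilityMeasure P] {X}

/-- The jumps up to the time `t` come from those points of the driving process that lie below the
cumulative rate at `t`. -/
theorem IsRegular.sum_jumps {ω : Ω} (hreg : X.IsRegular ω) {t : ℝ≥0}
    (ht : (t : ℝ≥0∞) < X.lifetime ω) {k : ℕ}
    (hk : X.clock k ω ≤ (cumulativeRate X.rate t ω).toReal)
    (hk' : (cumulativeRate X.rate t ω).toReal < X.clock (k + 1) ω) :
    ∑ᶠ p ∈ X.jumpPointsUpTo t ω, X.jump p.1 ω p.2 = ∑ j ∈ Finset.range k,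
      X.jump (inverseRate X.rate (X.clock (j + 1) ω) ω).toNNReal ω (X.u j ω) := by
  classical
  have htop := cumulativeRate_ne_top ht
  have hle : ∀ i, inverseRate X.rate (X.clock (i + 1) ω) ω ≤ t ↔ i < k := by
    intro i
    rw [inverseRate_le_iff ht, ENNReal.ofReal_le_iff_le_toReal htop]
    constructor
    · intro h
      by_contra! hik
      exact absurd (hk'.trans_le (hreg.clock_strictMono.monotone (Nat.succ_le_succ hik)))
        (not_lt.2 h)
    · intro h
      exact (hreg.clock_strictMono.monotone h).trans hk
  have hcoe : ∀ i < k, (((inverseRate X.rate (X.clock (i + 1) ω) ω).toNNReal : ℝ≥0) : ℝ≥0∞) =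
      inverseRate X.rate (X.clock (i + 1) ω) ω := fun i hi =>
    ENNReal.coe_toNNReal (((hle i).2 hi).trans_lt ENNReal.coe_lt_top).ne
  have hset : X.jumpPointsUpTo t ω = ↑((Finset.range k).image fun j =>
      ((inverseRate X.rate (X.clock (j + 1) ω) ω).toNNReal, X.u j ω)) := by
    ext p
    simp only [jumpPointsUpTo, jumpPoints, mem_ofPred_eq, Finset.coe_image, Finset.coe_range,
      mem_image, mem_Iio]
    constructor
    · rintro ⟨⟨i, h1, h2⟩, h3⟩
      have h1' : inverseRate X.rate (X.clock (i + 1) ω) ω = p.1 := h1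
      refine ⟨i, (hle i).1 ?_, ?_⟩
      · rw [h1']; exact ENNReal.coe_le_coe.2 h3
      · rw [h1', h2]; rfl
    · rintro ⟨i, hi, rfl⟩
      refine ⟨⟨i, (hcoe i hi).symm, rfl⟩, ENNReal.coe_le_coe.1 ?_⟩
      simp only [hcoe i hi]
      exact (hle i).2 hi
  rw [hset, finsum_mem_coe_finset, Finset.sum_image]
  intro i hi j hj hij
  have hi' : i < k := by simpa using hi
  have hj' : j < k := by simpa using hj
  have hlt : ∀ a b, a < k → a < b → inverseRate X.rate (X.clock (a + 1) ω) ω <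
      inverseRate X.rate (X.clock (b + 1) ω) ω := fun a b ha hab =>
    inverseRate_lt_inverseRate (lt_of_le_of_lt ((hle a).2 ha) ht) (hreg.clock_succ_pos b)
      (hreg.clock_strictMono (Nat.succ_lt_succ hab))
  have heq : inverseRate X.rate (X.clock (i + 1) ω) ω =
      inverseRate X.rate (X.clock (j + 1) ω) ω := by
    rw [← hcoe i hi', ← hcoe j hj', (Prod.mk.inj hij).1]
  rcases lt_trichotomy i j with h | h | h
  · exact absurd heq (hlt i j hi' h).ne
  · exact h
  · exact absurd heq (hlt j i hj' h).ne'

end HybridJumpProcess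

/-! ### The exponential process in closed form, and the estimate -/

namespace HybridJumpProcess

variable {Ω : Type*} [mΩ : MeasurableSpace Ω] {P : Measure Ω} [IsProbabilityMeasure P]
  (X : HybridJumpProcess P)

/-- The jump function in the time scale of the driving process, counted from its `k`-th point. -/
noncomputable def pastJump (k : ℕ) : X.Past k → ℝ → unitInterval → ℝ :=
  (exists_past_jump_clock (X := X) k).choose

/-- The factor by which `e^{θX}` is multiplied at the next point of the driving process. -/
noncomputable def jumpFactor (θ : ℝ) (k : ℕ) (ω : X.Past k) (y : ℝ) (v : unitInterval) : ℝ≥0∞ :=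
  ENNReal.ofReal (Real.exp (θ * X.pastJump k ω y v))

theorem measurable_jumpFactor (θ : ℝ) (k : ℕ) :
    Measurable fun p : X.Past k × ℝ × unitInterval => X.jumpFactor θ k p.1 p.2.1 p.2.2 :=
  ENNReal.measurable_ofReal.comp (Real.measurable_exp.comp
    ((exists_past_jump_clock (X := X) k).choose_spec.1.const_mul θ))

/-- The mean factor `∫ e^{θ Δ_s(v)} dv`. -/
noncomputable def meanExpJump (θ : ℝ) (ω : Ω) (s : ℝ≥0) : ℝ≥0∞ :=
  ∫⁻ v, ENNReal.ofReal (Real.exp (θ * X.jump s ω v))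

variable {X}

/-- The multiplicative process between the `m`-th point and the next one, in closed form. -/
theorem IsRegular.multiplicativeChain_mul {ω : Ω} (hreg : X.IsRegular ω) (θ : ℝ) {t : ℝ≥0}
    (ht : (t : ℝ≥0∞) < X.lifetime ω) (m : ℕ) {y : ℝ} (hy : 0 ≤ y) (hyw : y ≤ X.w m ω)
    (hyt : X.clock m ω + y ≤ (cumulativeRate X.rate t ω).toReal) :
    multiplicativeChain (X.jumpFactor θ) m ω * compensatingFactor (X.jumpFactor θ) m ω y =
      ENNReal.ofReal (Real.exp (X.clock m ω + y)) *
        expNeg (∫⁻ v in Ioc 0 (X.clock m ω + y),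
          X.meanExpJump θ ω (inverseRate X.rate v ω).toNNReal) *
        ENNReal.ofReal (Real.exp (θ * ∑ j ∈ Finset.range m,
          X.jump (inverseRate X.rate (X.clock (j + 1) ω) ω).toNNReal ω (X.u j ω))) := by
  set H : ℝ → ℝ≥0∞ := fun v => X.meanExpJump θ ω (inverseRate X.rate v ω).toNNReal with hH
  have htop := cumulativeRate_ne_top ht
  have hJ : ∀ k, ∀ x, 0 < x → x ≤ X.w k ω →
      X.clock k ω + x ≤ (cumulativeRate X.rate t ω).toReal → ∀ v, X.pastJump k ω x v =
        X.jump (inverseRate X.rate (X.clock k ω + x) ω).toNNReal ω v := by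
    intro k x hx hxw hxt
    have hle : inverseRate X.rate (X.clock k ω + x) ω ≤ t := by
      rw [inverseRate_le_iff ht, ENNReal.ofReal_le_iff_le_toReal htop]
      exact hxt
    have hcoe := (ENNReal.coe_toNNReal (hle.trans_lt ENNReal.coe_lt_top).ne).symm
    refine (exists_past_jump_clock (X := X) k).choose_spec.2 ω hreg x hx hxw _ hcoe ?_
    rw [← hcoe]
    exact hle.trans_lt ht
  have hE : ∀ k, ∀ x, 0 ≤ x → x ≤ X.w k ω →
      X.clock k ω + x ≤ (cumulativeRate X.rate t ω).toReal →
      compensatingFactor (X.jumpFactor θ) k ω x = ENNReal.ofReal (Real.exp x) *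
        expNeg (∫⁻ v in Ioc (X.clock k ω) (X.clock k ω + x), H v) := by
    intro k x hx hxw hxt
    unfold compensatingFactor
    congr 2
    calc ∫⁻ z in Ioc 0 x, meanFactor (X.jumpFactor θ) k ω z
        = ∫⁻ z in Ioc 0 x, H (X.clock k ω + z) := by
          refine setLIntegral_congr_fun measurableSet_Ioc fun z hz => lintegral_congr fun v => ?_
          unfold jumpFactor
          rw [hJ k z hz.1 (hz.2.trans hxw) (by linarith [hz.2])]
      _ = ∫⁻ v in Ioc (X.clock k ω) (X.clock k ω + x), H v := by
          have h := (measurePreserving_add_left volume (X.clock k ω)).setLIntegral_comp_preimage_emb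
            (measurableEmbedding_addLeft _) H (Ioc (X.clock k ω) (X.clock k ω + x))
          rw [← h]
          simp
  have hclock : ∀ k, 0 ≤ X.clock k ω := fun k => Finset.sum_nonneg fun i _ => (hreg.w_pos i).le
  have hsplit : ∀ k, ∀ x, 0 ≤ x → ∫⁻ v in Ioc 0 (X.clock k ω + x), H v =
      (∫⁻ v in Ioc 0 (X.clock k ω), H v) +
        ∫⁻ v in Ioc (X.clock k ω) (X.clock k ω + x), H v := by
    intro k x hx
    rw [← Ioc_union_Ioc_eq_Ioc (hclock k) (by linarith : X.clock k ω ≤ X.clock k ω + x),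
      lintegral_union measurableSet_Ioc (Ioc_disjoint_Ioc_of_le le_rfl)]
  induction m generalizing y with
  | zero =>
    rw [hE 0 y hy hyw hyt]
    simp [multiplicativeChain, clock]
  | succ m ih =>
    have hw := (hreg.w_pos m)
    have hwt : X.clock m ω + X.w m ω ≤ (cumulativeRate X.rate t ω).toReal := by
      rw [← clock_succ]; linarith
    have hprev := ih hw.le le_rfl hwt
    have hf : X.jumpFactor θ m ω (X.w m ω) (X.u m ω) = ENNReal.ofReal (Real.exp (θ *
        X.jump (inverseRate X.rate (X.clock (m + 1) ω) ω).toNNReal ω (X.u m ω))) := by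
      unfold jumpFactor
      rw [hJ m _ hw le_rfl hwt, ← clock_succ]
    have hchain : multiplicativeChain (X.jumpFactor θ) (m + 1) ω =
        multiplicativeChain (X.jumpFactor θ) m ω *
          compensatingFactor (X.jumpFactor θ) m ω (X.w m ω) *
          X.jumpFactor θ m ω (X.w m ω) (X.u m ω) := (mul_assoc _ _ _).symm
    rw [hprev, hf] at hchain
    rw [hE (m + 1) y hy hyw hyt, hsplit (m + 1) y hy, hchain, expNeg_add,
      Real.exp_add (X.clock (m + 1) ω) y, ENNReal.ofReal_mul (Real.exp_pos _).le,
      Finset.sum_range_succ _ m, mul_add θ, Real.exp_add (θ * ∑ j ∈ Finset.range m, _),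
      ENNReal.ofReal_mul (Real.exp_pos _).le, ← clock_succ]
    ring

/-- If the compensated process exceeds the bound, then the multiplicative process exceeds
`e^{la}`. -/
theorem IsRegular.le_multiplicativeChain {ω : Ω} (hreg : X.IsRegular ω) {t : ℝ≥0}
    (ht : (t : ℝ≥0∞) < X.lifetime ω) {c l a ε : ℝ} (hl : 0 < l) (hε : |ε| = 1)
    (hderiv : IntegrableOn (fun s => X.deriv s ω) (Iic t) timeMeasure)
    (hbound : ∀ᵐ (s : ℝ≥0) ∂timeMeasure, (s : ℝ≥0∞) < X.lifetime ω → ∀ᵐ v, |X.jump s ω v| ≤ c)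
    (h : a + l / 2 * Real.exp (l * c) * X.quadraticVariation t ω ≤ ε * X.compensated t ω) :
    ∃ k, ∃ y : ℝ, 0 ≤ y ∧ y < X.w k ω ∧ ENNReal.ofReal (Real.exp (l * a)) ≤
      multiplicativeChain (X.jumpFactor (ε * l)) k ω *
        compensatingFactor (X.jumpFactor (ε * l)) k ω y := by
  classical
  set θ := ε * l with hθ
  have hθabs : |θ| = l := by rw [hθ, abs_mul, hε, one_mul, abs_of_pos hl]
  have hθsq : θ ^ 2 = l ^ 2 := by rw [← sq_abs, hθabs]
  have htop := cumulativeRate_ne_top ht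
  set V := (cumulativeRate X.rate t ω).toReal with hV
  -- `k` is the number of jumps up to the time `t`.
  obtain ⟨k, hk, hk'⟩ : ∃ k, X.clock k ω ≤ V ∧ V < X.clock (k + 1) ω := by
    have hex := hreg.clock_unbounded V
    have h0 : Nat.find hex ≠ 0 := fun h0 => by
      have := Nat.find_spec hex
      rw [h0] at this
      exact absurd this (not_lt.2 (by simp [clock, hV]))
    obtain ⟨k, hk⟩ := Nat.exists_eq_succ_of_ne_zero h0
    refine ⟨k, not_lt.1 (Nat.find_min hex (by omega)), ?_⟩
    have := Nat.find_spec hex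
    rwa [hk] at this
  have hclock := X.clock_succ k ω
  refine ⟨k, V - X.clock k ω, by linarith, by linarith, ?_⟩
  rw [hreg.multiplicativeChain_mul θ ht k (by linarith) (by linarith) (by linarith),
    add_sub_cancel, ← hreg.sum_jumps ht hk hk']
  set S := ∑ᶠ p ∈ X.jumpPointsUpTo t ω, X.jump p.1 ω p.2 with hS
  have hlife : ∀ s ∈ Iic t, (s : ℝ≥0∞) < X.lifetime ω := fun s hs =>
    lt_of_le_of_lt (ENNReal.coe_le_coe.2 hs) ht
  set μ := timeMeasure.restrict (Iic t) with hμ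
  obtain ⟨g, hg, hgX⟩ := X.exists_measurable_jump
  set j : ℝ≥0 → unitInterval → ℝ := fun s v => g s ω v with hj
  have hjm : Measurable (Function.uncurry j) :=
    hg.comp (by fun_prop : Measurable fun p : ℝ≥0 × unitInterval => ((p.1, ω), p.2))
  have hjX : ∀ s ∈ Iic t, j s = X.jump s ω := fun s hs => hgX s ω (hlife s hs)
  have hmem : ∀ᵐ s ∂μ, s ∈ Iic t := ae_restrict_mem measurableSet_Iic
  have hjc : ∀ᵐ s ∂μ, ∀ᵐ v, |j s v| ≤ c := by
    filter_upwards [hmem, ae_restrict_of_ae hbound] with s hs hb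
    rw [hjX s hs]
    exact hb (hlife s hs)
  have hq : Measurable fun s => X.rate s ω := X.measurable_rate.of_uncurry_right
  obtain ⟨n, t', htt', hn⟩ := exists_bound_of_lt_explosionTime ht
  have hqn : ∀ᵐ s ∂μ, X.rate s ω ≤ (n : ℝ≥0) := by
    filter_upwards [hmem] with s hs using hn s (lt_of_le_of_lt hs htt')
  obtain ⟨hi1, hi2, hle⟩ := integral_exp_le_of_bounded hq hqn hjm hjc θ
  have hqV : ∫ s, (X.rate s ω : ℝ) ∂μ = V := by
    rw [integral_eq_lintegral_of_nonneg_ae (Eventually.of_forall fun s => (X.rate s ω).coe_nonneg)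
      hq.coe_nnreal_real.aestronglyMeasurable, hV]
    simp only [ENNReal.ofReal_coe_nnreal]
    rfl
  have hQV : X.quadraticVariation t ω = ∫ s, ((X.rate s ω : ℝ) * ∫ v, j s v ^ 2) ∂μ :=
    setIntegral_congr_fun measurableSet_Iic fun s hs => by
      simp only [diffusivity, hjX s hs]
  have hM : X.compensated t ω = S - ∫ s, ((X.rate s ω : ℝ) * ∫ v, j s v) ∂μ := by
    have hdrift : ∫ s in Iic t, X.drift s ω ∂timeMeasure =
        (∫ s in Iic t, X.deriv s ω ∂timeMeasure) + ∫ s, ((X.rate s ω : ℝ) * ∫ v, j s v) ∂μ := by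
      rw [← integral_add hderiv hi1]
      exact setIntegral_congr_fun measurableSet_Iic fun s hs => by
        simp only [drift, hjX s hs]
    unfold compensated process compensator
    rw [hdrift]
    ring
  have hI : ∫⁻ v in Ioc 0 V, X.meanExpJump θ ω (inverseRate X.rate v ω).toNNReal =
      ENNReal.ofReal (∫ s, ((X.rate s ω : ℝ) * ∫ v, Real.exp (θ * j s v)) ∂μ) := by
    set G : ℝ≥0 → ℝ≥0∞ := fun s => ∫⁻ v, ENNReal.ofReal (Real.exp (θ * j s v)) with hG
    have hGm : Measurable G := by
      refine Measurable.lintegral_prod_right'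
        (f := fun p : ℝ≥0 × unitInterval => ENNReal.ofReal (Real.exp (θ * j p.1 p.2))) ?_
      exact ENNReal.measurable_ofReal.comp (Real.measurable_exp.comp (hjm.const_mul θ))
    calc ∫⁻ v in Ioc 0 V, X.meanExpJump θ ω (inverseRate X.rate v ω).toNNReal
        = ∫⁻ v in Ioc 0 V, G (inverseRate X.rate v ω).toNNReal := by
          refine setLIntegral_congr_fun measurableSet_Ioc fun v hv => ?_
          have hle : inverseRate X.rate v ω ≤ t := by
            rw [inverseRate_le_iff ht, ENNReal.ofReal_le_iff_le_toReal htop]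
            exact hv.2
          have hmem : (inverseRate X.rate v ω).toNNReal ∈ Iic t :=
            ENNReal.toNNReal_mono ENNReal.coe_ne_top hle
          simp only [hG, meanExpJump, hjX _ hmem]
      _ = ∫⁻ s, G s ∂(μ.withDensity fun s => (X.rate s ω : ℝ≥0∞)) := by
          rw [hμ, ← map_inverseRate ht, lintegral_map hGm]
          exact inverseRate_mono.measurable.ennreal_toNNReal
      _ = ∫⁻ s, (X.rate s ω : ℝ≥0∞) * G s ∂μ :=
          lintegral_withDensity_eq_lintegral_mul _ hq.coe_nnreal_ennreal hGm
      _ = ∫⁻ s, ENNReal.ofReal ((X.rate s ω : ℝ) * ∫ v, Real.exp (θ * j s v)) ∂μ := by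
          refine lintegral_congr_ae ?_
          filter_upwards [hjc] with s hs
          have hint : Integrable (fun v => Real.exp (θ * j s v)) := by
            have hjs : Measurable (j s) := hjm.comp measurable_prodMk_left
            refine Integrable.of_bound
              (Real.measurable_exp.comp (hjs.const_mul θ)).aestronglyMeasurable
              (Real.exp (l * c)) ?_
            filter_upwards [hs] with v hv
            rw [Real.norm_of_nonneg (Real.exp_pos _).le, Real.exp_le_exp]
            refine (le_abs_self _).trans ?_
            rw [abs_mul, hθabs]
            gcongr
          rw [ENNReal.ofReal_mul (X.rate s ω).coe_nonneg, ENNReal.ofReal_coe_nnreal,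
            ofReal_integral_eq_lintegral_ofReal hint
              (Eventually.of_forall fun v => (Real.exp_pos _).le)]
      _ = _ := by
          rw [ofReal_integral_eq_lintegral_ofReal hi2 (Eventually.of_forall fun s => ?_)]
          exact mul_nonneg (X.rate s ω).coe_nonneg
            (integral_nonneg fun v => (Real.exp_pos _).le)
  rw [hI, expNeg_ofReal (integral_nonneg fun s => mul_nonneg (X.rate s ω).coe_nonneg
      (integral_nonneg fun v => (Real.exp_pos _).le)),
    ← ENNReal.ofReal_mul (Real.exp_pos _).le, ← Real.exp_add,
    ← ENNReal.ofReal_mul (Real.exp_pos _).le, ← Real.exp_add]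
  refine ENNReal.ofReal_le_ofReal (Real.exp_le_exp.2 ?_)
  rw [hqV, hθsq, hθabs] at hle
  rw [hQV, hM] at h
  have h' := mul_le_mul_of_nonneg_left h hl.le
  have hθS : θ * S = l * (ε * S) := by rw [hθ]; ring
  have hθI : θ * (∫ s, ((X.rate s ω : ℝ) * ∫ v, j s v) ∂μ) =
      l * (ε * ∫ s, ((X.rate s ω : ℝ) * ∫ v, j s v) ∂μ) := by rw [hθ]; ring
  rw [hθS]
  rw [hθI] at hle
  linarith

/-- The maximal inequality for the compensated process, with a sign `ε = ±1`. -/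
theorem measure_compensated_ge_le (X : HybridJumpProcess P) {c l a ε : ℝ} (hX : X.JumpBoundedBy c)
    (hl : 0 < l) (hε : |ε| = 1) :
    P {ω | ∃ t : ℝ≥0, (t : ℝ≥0∞) < X.lifetime ω ∧
        a + l / 2 * Real.exp (l * c) * X.quadraticVariation t ω ≤ ε * X.compensated t ω}
      ≤ ENNReal.ofReal (Real.exp (-(l * a))) := by
  have hb : ENNReal.ofReal (Real.exp (l * a)) ≠ 0 := by
    simpa using Real.exp_pos (l * a)
  have hmax := measure_reaches_le (X.measurable_jumpFactor (ε * l)) X.isMarkedPoisson hb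
    ENNReal.ofReal_ne_top
  rw [← ENNReal.ofReal_inv_of_pos (Real.exp_pos _), ← Real.exp_neg] at hmax
  refine le_trans (measure_mono_ae ?_) hmax
  filter_upwards [X.ae_isRegular, X.ae_integrableOn_deriv, X.ae_jump_bounded hX]
    with ω hreg hderiv hbound
  rintro ⟨t, ht, h⟩
  exact hreg.le_multiplicativeChain ht hl hε (hderiv t ht) hbound h

end HybridJumpProcess

theorem theorem4 {Ω : Type*} [MeasurableSpace Ω] (P : Measure Ω) [IsProbabilityMeasure P]
    (X : HybridJumpProcess P) (c : ℝ) (hc : 0 < c) (hX : X.JumpBoundedBy c)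
    (l a : ℝ) (hl : 0 < l) (ha : 0 < a) :
    P {ω | ∃ t : ℝ≥0, (t : ℝ≥0∞) < X.lifetime ω ∧
        a + l / 2 * Real.exp (l * c) * X.quadraticVariation t ω ≤ X.compensated t ω}
      ≤ ENNReal.ofReal (Real.exp (-(l * a))) ∧
    P {ω | ∃ t : ℝ≥0, (t : ℝ≥0∞) < X.lifetime ω ∧
        a + l / 2 * Real.exp (l * c) * X.quadraticVariation t ω ≤ -X.compensated t ω}
      ≤ ENNReal.ofReal (Real.exp (-(l * a))) := by
  constructor
  · simpa only [one_mul] using X.measure_compensated_ge_le (a := a) (ε := 1) hX hl abs_one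
  · simpa only [neg_one_mul] using
      X.measure_compensated_ge_le (a := a) (ε := -1) hX hl (by rw [abs_neg, abs_one])
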